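/- Let $\mathcal X$ be a measurable space, let $P$ be a probability measure on $\mathcal X$ (the distribution of the normal class, $\mathcal D_{\mathcal X\mid\mathcal Y=+1}$), and let $\mathcal F$ be a class of measurable functions $f:\mathcal X\to\mathbb R$ that is pointwise separable, i.e. there is a countable $\mathcal F_0\subseteq\mathcal F$ such that every $f\in\mathcal F$ is the pointwise limit of a sequence in $\mathcal F_0$. For $f\in\mathcal F$ and $\theta\in\mathbb R$ put $R_{f,\theta}=\{x: f(x)\ge\theta\}$, and write $[t]_+=\max(0,t)$. For $x_1,\dots,x_n\in\mathcal X$ let $$\hat{\mathcal R}_n(\mathcal F)=\mathbb E_\sigma\Big[\sup_{f\in\mathcal F}\Big|\frac2n\sum_{i=1}^n\sigma_i f(x_i)\Big|\Big]\in[0,\infty],$$ where $\sigma_1,\dots,\sigma_n$ are independent and uniform on $\{-1,+1\}$. Let $n\ge1$ and $\eta\in(0,1]$. Then, with probability at least $1-\eta$ over an i.i.d. sample $(x_1,\dots,x_n)\sim P^n$, the following holds simultaneously for all $f\in\mathcal F$ and all $\kappa>0$: $$P\big(x\notin R_{f,1-\kappa}\big)\;\le\;\frac1{\kappa n}\sum_{i=1}^n[1-f(x_i)]_+\;+\;\frac2\kappa\,\hat{\mathcal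 R}_n(\mathcal F)\;+\;3\sqrt{\frac{\ln(2/\eta)}{2n}} .$$ -/

import Mathlib

open MeasureTheory Filter Topology
open scoped ENNReal

/-- The decision region `R_{f,θ} = {x : f x ≥ θ}`. -/
def decisionRegion {X : Type*} (f : X → ℝ) (θ : ℝ) : Set X := {x | θ ≤ f x}

/-- The margin error `ξ = [1 - f x]₊` of `f` at `x`. -/
noncomputable def marginError {X : Type*} (f : X → ℝ) (x : X) : ℝ := max 0 (1 - f x)

/-- The empirical Rademacher complexity of `F` on the sample `x 0, …, x (n-1)`:
`𝔼_σ sup_{f ∈ F} |(2/n) ∑ i, σ i * f (x i)|`, the sign vector `σ` being uniform on `{±1}ⁿ`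
(`ℤˣ = {1, -1}`). The value lies in `[0, ∞]`, so that no boundedness of `F` is needed. -/
noncomputable def empRademacher {X : Type*} {n : ℕ} (F : Set (X → ℝ)) (x : Fin n → X) : ℝ≥0∞ :=
  (∑ σ : Fin n → ℤˣ,
    ⨆ f ∈ F, ENNReal.ofReal |(2 / (n : ℝ)) * ∑ i, ((σ i : ℤ) : ℝ) * f (x i)|) / 2 ^ n

/-- `F` is pointwise separable: it has a countable subset from which every member of `F` is
obtained as the pointwise limit of a sequence. This is the usual condition that makes suprema over
`F` measurable. -/
def PointwiseSeparable {X : Type*} (F : Set (X → ℝ)) : Prop :=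
  ∃ F₀ : Set (X → ℝ), F₀ ⊆ F ∧ F₀.Countable ∧
    ∀ f ∈ F, ∃ g : ℕ → X → ℝ, (∀ k, g k ∈ F₀) ∧
      ∀ x, Tendsto (fun k => g k x) atTop (𝓝 (f x))

/-! Put `lam = 1/κ`, `ρ = √n · empRademacher F x` and `T = 3√(ln(2/η)/2)`. The indicator of `f < 1 -
κ` lies below the ramp `min 1 [lam(1 - f)]₊`, which lies below `lam · [1 - f]₊`. So it suffices to
bound `√n` times (mean minus empirical mean) of the ramps by `T + 2·lam·ρ`, uniformly in `f` and
`lam`.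

For scales in one interval `[a, b]`, McDiarmid and symmetrization bound this deviation by `Q + s`
outside an event of probability `exp(-2s²)`, where `Q` is `√n` times the expected one-sided
Rademacher average of the ramps. Contraction bounds `√n` times that average, sample by sample, by
`b·ρ + (b - a)` (`rademacherAverage_ramp_le`). This uses only about `lam·ρ` of the available
`2·lam·ρ`; the rest pays for a union bound over infinitely many intervals.

Replacing the expectation `Q` by the empirical `ρ` costs no probability per interval. Let `M` be a
quantile of `ρ` at level `0.8η`. If the lower-tail bound of the Rademacher average at depth `d` is
smaller than the probability of `ρ ≤ M`, some sample has both `ρ ≤ M` and scaled average above `Q -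
d`, whence the deterministic bound `Q ≤ bM + (b - a) + d` (`exists_uniform_ramp_bound`). For `η`
near 1 the depth `d` must be small, and there a Cantelli bound beats the exponential one.

Two regimes remain. If `M ≥ 0.4`, the event `ρ ≥ M` is imposed at cost `0.8η`, and intervals growing
geometrically have margins paid by `lam·M`. If `M < 0.4`, intervals of length `0.2` are used: when
the margin term is below 1 the mean of `f` on the sample is bounded below, and a Khinchine-type
inequality forces `2·lam·ρ ≥ 2.3(lam - 1)`, which pays for large scales. The numerical constants
make both budgets close exactly at `T = 1.766 + τ`. -/

/-! ### Concentration of functions with bounded differences. -/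

section BoundedDifferences

open ProbabilityTheory

variable {X : Type*} [MeasurableSpace X]

/-- Integrating over `n + 1` independent coordinates, the first one last. -/
lemma integral_pi_succ {P : Measure X} [IsProbabilityMeasure P] {n : ℕ}
    (g : (Fin (n + 1) → X) → ℝ) (hg : Measurable g) {K : ℝ} (hK : ∀ x, |g x| ≤ K) :
    ∫ x, g x ∂(Measure.pi fun _ => P)
      = ∫ y, ∫ a, g (Fin.cons a y) ∂P ∂(Measure.pi fun _ : Fin n => P) := by
  have hmp := (measurePreserving_piFinSuccAbove (fun _ : Fin (n + 1) => P) 0).symm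
  rw [← hmp.integral_comp (MeasurableEquiv.measurableEmbedding _), integral_prod_symm]
  · simp [MeasurableEquiv.piFinSuccAbove_symm_apply, Fin.insertNthEquiv]
  · exact Integrable.of_bound (hg.comp (MeasurableEquiv.measurable _)).aestronglyMeasurable K
      (ae_of_all _ fun p => hK _)

lemma measurable_fin_cons {n : ℕ} :
    Measurable fun p : X × (Fin n → X) => (Fin.cons p.1 p.2 : Fin (n + 1) → X) := by
  refine measurable_pi_iff.2 fun i => ?_
  refine Fin.cases ?_ (fun j => ?_) i
  · simpa using measurable_fst
  · simpa [Function.comp_def] using (measurable_pi_apply j).comp (measurable_snd (α := X))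

/-- Hoeffding's lemma for a bounded function whose oscillation is at most `c`. -/
lemma integral_exp_le_of_oscillation {P : Measure X} [IsProbabilityMeasure P] {g : X → ℝ}
    (hg : Measurable g) {c : ℝ} (hc : ∀ a b, |g a - g b| ≤ c) (t : ℝ) :
    ∫ a, Real.exp (t * (g a - ∫ b, g b ∂P)) ∂P ≤ Real.exp ((c / 2) ^ 2 * t ^ 2 / 2) := by
  have : Nonempty X := nonempty_of_isProbabilityMeasure P
  have hbdd : BddBelow (Set.range g) := by
    obtain ⟨a₀⟩ := this
    exact ⟨g a₀ - c, by rintro _ ⟨b, rfl⟩; linarith [(abs_le.1 (hc a₀ b)).2]⟩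
  have hmem : ∀ a, g a ∈ Set.Icc (⨅ b, g b) ((⨅ b, g b) + c) := fun a => by
    refine ⟨ciInf_le hbdd a, ?_⟩
    have : g a - c ≤ ⨅ b, g b := le_ciInf fun b => by linarith [(abs_le.1 (hc a b)).2]
    linarith
  have h := (hasSubgaussianMGF_of_mem_Icc (μ := P) hg.aemeasurable (ae_of_all _ hmem)).mgf_le t
  simp only [mgf] at h
  refine h.trans (le_of_eq ?_)
  simp [div_pow]

/-- **McDiarmid's inequality**, moment generating function form. -/
theorem integral_exp_le_of_bounded_differences {P : Measure X} [IsProbabilityMeasure P] {c : ℝ}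
    (t : ℝ) : ∀ {n : ℕ} (f : (Fin n → X) → ℝ) (_ : Measurable f) {K : ℝ} (_ : ∀ x, |f x| ≤ K)
      (_ : ∀ x i a, |f x - f (Function.update x i a)| ≤ c),
    ∫ x, Real.exp (t * (f x - ∫ y, f y ∂(Measure.pi fun _ => P))) ∂(Measure.pi fun _ => P)
      ≤ Real.exp (n * (c / 2) ^ 2 * t ^ 2 / 2)
  | 0, f, _, K, hK, _ => by
    have : ∀ x, f x = f default := fun x => by rw [Subsingleton.elim x default]
    have h2 : ∫ y, f y ∂(Measure.pi fun _ : Fin 0 => P) = f default := by simp [this]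
    simp [this]
  | n + 1, f, hf, K, hK, hd => by
    have hfc : Measurable fun p : X × (Fin n → X) => f (Fin.cons p.1 p.2) :=
      hf.comp measurable_fin_cons
    set μ := Measure.pi fun _ : Fin n => P
    -- Averaging out one coordinate preserves the bounded differences, so the induction applies to
    -- `g`; Hoeffding's lemma handles the averaged coordinate with the others frozen.
    set g : (Fin n → X) → ℝ := fun y => ∫ a, f (Fin.cons a y) ∂P with hgdef
    have hfa : ∀ y, Measurable fun a => f (Fin.cons a y) := fun y =>
      hfc.comp (measurable_id.prodMk measurable_const)
    have hint : ∀ y, Integrable (fun a => f (Fin.cons a y)) P := fun y =>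
      Integrable.of_bound (hfa y).aestronglyMeasurable K (ae_of_all _ fun a => hK _)
    have hg : Measurable g := (hfc.stronglyMeasurable.integral_prod_left').measurable
    have hgK : ∀ y, |g y| ≤ K := fun y => by
      have := norm_integral_le_of_norm_le_const (μ := P) (f := fun a => f (Fin.cons a y)) (C := K)
        (ae_of_all _ fun a => hK _)
      simpa using this
    have hgd : ∀ y i a, |g y - g (Function.update y i a)| ≤ c := fun y i b => by
      rw [hgdef]
      simp only
      rw [← integral_sub (hint _) (hint _)]
      have := norm_integral_le_of_norm_le_const (μ := P)
        (f := fun a => f (Fin.cons a y) - f (Fin.cons a (Function.update y i b))) (C := c)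
        (ae_of_all _ fun a => by
          rw [Fin.cons_update]
          exact hd _ _ _)
      simpa using this
    have hE : ∫ x, f x ∂(Measure.pi fun _ => P) = ∫ y, g y ∂μ := integral_pi_succ f hf hK
    have ih := integral_exp_le_of_bounded_differences (P := P) t g hg hgK hgd
    rw [hE]
    set m := ∫ y, g y ∂μ
    have hm : |m| ≤ K := by
      have := norm_integral_le_of_norm_le_const (μ := μ) (f := g) (C := K)
        (ae_of_all _ fun a => hgK _)
      simpa using this
    have hexpK : ∀ s, |s| ≤ K → |Real.exp (t * (s - m))| ≤ Real.exp (|t| * (K + K)) := fun s hs => by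
      rw [abs_of_pos (Real.exp_pos _), Real.exp_le_exp]
      calc t * (s - m) ≤ |t * (s - m)| := le_abs_self _
        _ = |t| * |s - m| := abs_mul _ _
        _ ≤ |t| * (K + K) := by
          gcongr
          exact (abs_sub _ _).trans (by linarith)
    rw [integral_pi_succ (fun x => Real.exp (t * (f x - m)))
      (Real.measurable_exp.comp ((hf.sub_const m).const_mul t)) (fun x => hexpK _ (hK x))]
    have hinner : ∀ y, ∫ a, Real.exp (t * (f (Fin.cons a y) - m)) ∂P
        ≤ Real.exp ((c / 2) ^ 2 * t ^ 2 / 2) * Real.exp (t * (g y - m)) := fun y => by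
      have h := integral_exp_le_of_oscillation (P := P) (hfa y) (c := c) (fun a b => by
        have := hd (Fin.cons a y) 0 b
        rwa [Fin.update_cons_zero] at this) t
      have heq : ∀ a, Real.exp (t * (f (Fin.cons a y) - m))
          = Real.exp (t * (f (Fin.cons a y) - ∫ b, f (Fin.cons b y) ∂P))
            * Real.exp (t * (g y - m)) := fun a => by
        rw [← Real.exp_add]; congr 1; simp only [hgdef]; ring
      simp_rw [heq]
      rw [integral_mul_const]
      gcongr
    calc ∫ y, ∫ a, Real.exp (t * (f (Fin.cons a y) - m)) ∂P ∂μ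
        ≤ ∫ y, Real.exp ((c / 2) ^ 2 * t ^ 2 / 2) * Real.exp (t * (g y - m)) ∂μ := by
          refine integral_mono_of_nonneg (ae_of_all _ fun y => ?_) ?_ (ae_of_all _ hinner)
          · exact integral_nonneg fun a => (Real.exp_pos _).le
          · exact (Integrable.of_bound
              (Real.measurable_exp.comp ((hg.sub_const m).const_mul t)).aestronglyMeasurable
              _ (ae_of_all _ fun y => hexpK _ (hgK y))).const_mul _
      _ = Real.exp ((c / 2) ^ 2 * t ^ 2 / 2) * ∫ y, Real.exp (t * (g y - m)) ∂μ :=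
          integral_const_mul _ _
      _ ≤ Real.exp ((c / 2) ^ 2 * t ^ 2 / 2) * Real.exp (n * (c / 2) ^ 2 * t ^ 2 / 2) := by gcongr
      _ = _ := by
          rw [← Real.exp_add]; congr 1; push_cast; ring

theorem hasSubgaussianMGF_of_bounded_differences {P : Measure X} [IsProbabilityMeasure P] {n : ℕ}
    {f : (Fin n → X) → ℝ} (hf : Measurable f) {K : ℝ} (hK : ∀ x, |f x| ≤ K) {c : ℝ}
    (hd : ∀ x i a, |f x - f (Function.update x i a)| ≤ c) :
    HasSubgaussianMGF (fun x => f x - ∫ y, f y ∂(Measure.pi fun _ => P))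
      (Real.toNNReal (n * (c / 2) ^ 2)) (Measure.pi fun _ => P) where
  integrable_exp_mul t :=
    integrable_exp_mul_of_mem_Icc (a := -K - ∫ y, f y ∂(Measure.pi fun _ => P))
      (b := K - ∫ y, f y ∂(Measure.pi fun _ => P)) (hf.sub_const _).aemeasurable
      (ae_of_all _ fun x => ⟨by linarith [(abs_le.1 (hK x)).1], by linarith [(abs_le.1 (hK x)).2]⟩)
  mgf_le t := by
    rw [Real.coe_toNNReal _ (by positivity)]
    exact integral_exp_le_of_bounded_differences t f hf hK hd

lemma one_add_sq_div_two_le_cosh (y : ℝ) : 1 + y ^ 2 / 2 ≤ Real.cosh y := by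
  have h1 : |y| / 2 ≤ Real.sinh (|y| / 2) := Real.self_le_sinh_iff.2 (by positivity)
  have h2 : Real.cosh y = Real.cosh (2 * (|y| / 2)) := by
    rw [mul_div_cancel₀ _ (two_ne_zero), Real.cosh_abs]
  rw [h2, Real.cosh_two_mul, Real.cosh_sq]
  nlinarith [sq_abs y, abs_nonneg y]

/-- The second moment of a sub-Gaussian variable is at most its variance proxy. -/
lemma integral_sq_le_of_hasSubgaussianMGF {Ω : Type*} [MeasurableSpace Ω] {μ : Measure Ω}
    [IsProbabilityMeasure μ] {Y : Ω → ℝ} {v : NNReal} (h : HasSubgaussianMGF Y v μ) :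
    ∫ ω, Y ω ^ 2 ∂μ ≤ v := by
  have hsq : Integrable (fun ω => Y ω ^ 2) μ := by
    simpa using (h.memLp 2).integrable_sq
  -- Integrating `cosh (tY) ≥ 1 + t²Y²/2` against the moment generating function bounds at `t` and
  -- `-t`; then `t → 0`.
  have key : ∀ t : ℝ, t ≠ 0 → ∫ ω, Y ω ^ 2 ∂μ ≤ (Real.exp (v * t ^ 2 / 2) - 1) / (t ^ 2 / 2) := by
    intro t ht
    have ht2 : 0 < t ^ 2 / 2 := by positivity
    rw [le_div_iff₀ ht2, ← integral_mul_const]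
    have hcosh : ∀ ω, Y ω ^ 2 * (t ^ 2 / 2)
        ≤ (Real.exp (t * Y ω) + Real.exp (-t * Y ω)) / 2 - 1 := fun ω => by
      have := one_add_sq_div_two_le_cosh (t * Y ω)
      rw [Real.cosh_eq] at this
      have e : -(t * Y ω) = -t * Y ω := by ring
      rw [e] at this
      nlinarith
    have i1 := h.integrable_exp_mul t
    have i2 := h.integrable_exp_mul (-t)
    calc ∫ ω, Y ω ^ 2 * (t ^ 2 / 2) ∂μ
        ≤ ∫ ω, ((Real.exp (t * Y ω) + Real.exp (-t * Y ω)) / 2 - 1) ∂μ :=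
          integral_mono (hsq.mul_const _) (((i1.add i2).div_const 2).sub (integrable_const _)) hcosh
      _ = (mgf Y μ t + mgf Y μ (-t)) / 2 - 1 := by
          have e := integral_sub ((i1.add i2).div_const 2) (integrable_const (μ := μ) (1 : ℝ))
          simp only [Pi.add_apply] at e
          rw [e, integral_div, integral_add i1 i2]
          simp [mgf]
      _ ≤ Real.exp (v * t ^ 2 / 2) - 1 := by
          have h1 := h.mgf_le t
          have h2 := h.mgf_le (-t)
          rw [neg_sq] at h2
          linarith
  refine le_of_forall_pos_le_add fun ε hε => ?_
  -- With `w = v t²/2 ≤ 1`, `exp w - 1 ≤ w + w²`, and dividing by `t²/2` leaves `v + v² t²/2 ≤ v +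
  -- ε`.
  obtain ⟨t, ht, h1, h2⟩ : ∃ t : ℝ, 0 < t ∧ (v : ℝ) * t ^ 2 / 2 ≤ 1 ∧ (v : ℝ) ^ 2 * t ^ 2 / 2 ≤ ε := by
    have l1 : Tendsto (fun t : ℝ => (v : ℝ) * t ^ 2 / 2) (𝓝[>] 0) (𝓝 0) := by
      have : Continuous fun t : ℝ => (v : ℝ) * t ^ 2 / 2 := by fun_prop
      simpa using this.continuousWithinAt.tendsto (x := (0 : ℝ)) (s := Set.Ioi 0)
    have l2 : Tendsto (fun t : ℝ => (v : ℝ) ^ 2 * t ^ 2 / 2) (𝓝[>] 0) (𝓝 0) := by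
      have : Continuous fun t : ℝ => (v : ℝ) ^ 2 * t ^ 2 / 2 := by fun_prop
      simpa using this.continuousWithinAt.tendsto (x := (0 : ℝ)) (s := Set.Ioi 0)
    obtain ⟨t, ⟨ht1, ht2⟩, ht3⟩ := (((l1.eventually_le_const one_pos).and
      (l2.eventually_le_const hε)).and self_mem_nhdsWithin).exists
    exact ⟨t, ht3, ht1, ht2⟩
  refine (key t ht.ne').trans ?_
  have hw : 0 ≤ (v : ℝ) * t ^ 2 / 2 := by positivity
  have he := (abs_le.1 (Real.abs_exp_sub_one_sub_id_le (x := (v : ℝ) * t ^ 2 / 2)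
    (by rw [abs_of_nonneg hw]; exact h1))).2
  have ht2 : 0 < t ^ 2 / 2 := by positivity
  rw [div_le_iff₀ ht2]
  nlinarith

/-- Lower tail of a function with bounded differences: Hoeffding-type and Cantelli-type bounds. -/
theorem measureReal_lower_tail_le_of_bounded_differences {P : Measure X} [IsProbabilityMeasure P]
    {n : ℕ} (hn : 1 ≤ n) {f : (Fin n → X) → ℝ} (hf : Measurable f) {K : ℝ} (hK : ∀ x, |f x| ≤ K)
    (hd : ∀ x i a, |f x - f (Function.update x i a)| ≤ 1 / n) {d : ℝ} (hd0 : 0 < d) :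
    (Measure.pi fun _ => P).real
        {x | Real.sqrt n * f x + d ≤ Real.sqrt n * ∫ y, f y ∂(Measure.pi fun _ => P)}
      ≤ min (Real.exp (-2 * d ^ 2)) (1 / (1 + 4 * d ^ 2)) := by
  set μ := Measure.pi fun _ : Fin n => P
  have hn0 : (0 : ℝ) < n := by exact_mod_cast hn
  have hs : 0 < Real.sqrt n := Real.sqrt_pos.2 hn0
  have hs2 : Real.sqrt n ^ 2 = n := Real.sq_sqrt hn0.le
  have h := hasSubgaussianMGF_of_bounded_differences (P := P) hf hK hd
  have hc : (Real.toNNReal (n * (1 / (n : ℝ) / 2) ^ 2) : ℝ) = 1 / (4 * n) := by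
    rw [Real.coe_toNNReal _ (by positivity)]; field_simp; norm_num
  set m := ∫ y, f y ∂μ
  have hset : {x | Real.sqrt n * f x + d ≤ Real.sqrt n * m}
      = {x | d / Real.sqrt n ≤ (-fun x => f x - m) x} := by
    ext x
    simp only [Set.mem_ofPred_eq, Pi.neg_apply]
    rw [div_le_iff₀ hs]
    constructor <;> intro h <;> nlinarith
  rw [hset]
  refine le_min ?_ ?_
  · refine (h.neg.measure_ge_le (by positivity)).trans (le_of_eq ?_)
    rw [hc, div_pow, hs2]
    congr 1
    field_simp
    norm_num
  · have hY := integral_sq_le_of_hasSubgaussianMGF h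
    rw [hc] at hY
    have hfi : Integrable f μ := Integrable.of_bound hf.aestronglyMeasurable K (ae_of_all _ hK)
    have hmean : ∫ x, (f x - m) ∂μ = 0 := by
      rw [integral_sub hfi (integrable_const _)]; simp [m]
    have hsq : Integrable (fun x => (f x - m) ^ 2) μ := by
      simpa using (h.memLp 2).integrable_sq
    -- The optimal shift in Cantelli's inequality: the variance bound `1/(4n)` divided by the
    -- deviation `d/√n`.
    set y : ℝ := 1 / (4 * d * Real.sqrt n)
    have hy : 0 < y := by positivity
    have hval : ∫ x, (y - (f x - m)) ^ 2 ∂μ ≤ y ^ 2 + 1 / (4 * n) := by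
      have e : ∀ x, (y - (f x - m)) ^ 2 = (f x - m) ^ 2 + (y ^ 2 - 2 * y * (f x - m)) := fun x => by
        ring
      simp_rw [e]
      have hi : Integrable (fun x => 2 * y * (f x - m)) μ := (hfi.sub (integrable_const m)).const_mul _
      have e1 : ∫ x, ((f x - m) ^ 2 + (y ^ 2 - 2 * y * (f x - m))) ∂μ
          = ∫ x, (f x - m) ^ 2 ∂μ + ∫ x, (y ^ 2 - 2 * y * (f x - m)) ∂μ :=
        integral_add hsq ((integrable_const _).sub hi)
      have e2 : ∫ x, (y ^ 2 - 2 * y * (f x - m)) ∂μ = y ^ 2 := by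
        rw [integral_sub (integrable_const _) hi, integral_const_mul, hmean]
        simp
      rw [e1, e2]
      linarith [hY]
    have hdy : 0 < d / Real.sqrt n + y := by positivity
    have hmarkov := mul_meas_ge_le_integral_of_nonneg (μ := μ) (f := fun x => (y - (f x - m)) ^ 2)
      (ae_of_all _ fun x => sq_nonneg _) (by
        have e : ∀ x, (y - (f x - m)) ^ 2 = (f x - m) ^ 2 + (y ^ 2 - 2 * y * (f x - m)) := fun x => by
          ring
        simp_rw [e]
        exact hsq.add ((integrable_const _).sub ((hfi.sub (integrable_const m)).const_mul _)))
      ((d / Real.sqrt n + y) ^ 2)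
    have hmono : μ.real {x | d / Real.sqrt n ≤ (-fun x => f x - m) x}
        ≤ μ.real {x | (d / Real.sqrt n + y) ^ 2 ≤ (y - (f x - m)) ^ 2} := by
      refine measureReal_mono fun x hx => ?_
      simp only [Set.mem_ofPred_eq, Pi.neg_apply] at hx ⊢
      exact pow_le_pow_left₀ hdy.le (by linarith) 2
    have h3 : μ.real {x | (d / Real.sqrt n + y) ^ 2 ≤ (y - (f x - m)) ^ 2}
        ≤ (y ^ 2 + 1 / (4 * n)) / (d / Real.sqrt n + y) ^ 2 := by
      rw [le_div_iff₀ (by positivity), mul_comm]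
      exact hmarkov.trans hval
    refine hmono.trans (h3.trans (le_of_eq ?_))
    have e1 : y = 1 / (4 * d * Real.sqrt n) := rfl
    have e2 : (4 * (n : ℝ)) = 4 * Real.sqrt n ^ 2 := by rw [hs2]
    rw [e2, e1]
    field_simp
    ring

theorem measureReal_upper_tail_le_of_bounded_differences {P : Measure X} [IsProbabilityMeasure P]
    {n : ℕ} (hn : 1 ≤ n) {f : (Fin n → X) → ℝ} (hf : Measurable f) {K : ℝ} (hK : ∀ x, |f x| ≤ K)
    (hd : ∀ x i a, |f x - f (Function.update x i a)| ≤ 1 / n) {s : ℝ} (hs0 : 0 ≤ s) :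
    (Measure.pi fun _ => P).real
        {x | Real.sqrt n * ∫ y, f y ∂(Measure.pi fun _ => P) + s ≤ Real.sqrt n * f x}
      ≤ Real.exp (-2 * s ^ 2) := by
  set μ := Measure.pi fun _ : Fin n => P
  have hn0 : (0 : ℝ) < n := by exact_mod_cast hn
  have hs : 0 < Real.sqrt n := Real.sqrt_pos.2 hn0
  have hs2 : Real.sqrt n ^ 2 = n := Real.sq_sqrt hn0.le
  have h := hasSubgaussianMGF_of_bounded_differences (P := P) hf hK hd
  have hc : (Real.toNNReal (n * (1 / (n : ℝ) / 2) ^ 2) : ℝ) = 1 / (4 * n) := by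
    rw [Real.coe_toNNReal _ (by positivity)]; field_simp; norm_num
  set m := ∫ y, f y ∂μ
  have hset : {x | Real.sqrt n * m + s ≤ Real.sqrt n * f x} = {x | s / Real.sqrt n ≤ f x - m} := by
    ext x
    simp only [Set.mem_ofPred_eq]
    rw [div_le_iff₀ hs]
    constructor <;> intro h <;> nlinarith
  rw [hset]
  refine (h.measure_ge_le (by positivity)).trans (le_of_eq ?_)
  rw [hc, div_pow, hs2]
  congr 1
  field_simp
  norm_num

end BoundedDifferences

/-! ### Sign vectors and flips of a single sign. -/

section Signs

variable {n : ℕ}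

lemma sign_eq_one_or (σ : Fin n → ℤˣ) (j : Fin n) :
    ((σ j : ℤ) : ℝ) = 1 ∨ ((σ j : ℤ) : ℝ) = -1 := by
  rcases Int.units_eq_one_or (σ j) with h | h <;> simp [h]

lemma abs_sign (σ : Fin n → ℤˣ) (j : Fin n) : |((σ j : ℤ) : ℝ)| = 1 := by
  rcases sign_eq_one_or σ j with h | h <;> simp [h]

/-- The sign vector `σ` with its `k`-th coordinate flipped. -/
def flipSign (k : Fin n) (σ : Fin n → ℤˣ) : Fin n → ℤˣ := Function.update σ k (-σ k)

lemma flipSign_involutive (k : Fin n) : Function.Involutive (flipSign k) := fun σ => by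
  simp [flipSign]

lemma sum_flipSign (k : Fin n) (F : (Fin n → ℤˣ) → ℝ) :
    2 * ∑ σ, F σ = ∑ σ, (F σ + F (flipSign k σ)) := by
  rw [Finset.sum_add_distrib, two_mul]
  congr 1
  exact (Equiv.sum_comp (flipSign_involutive k).toPerm F).symm

lemma sum_sign_mul_eq (k : Fin n) (σ : Fin n → ℤˣ) (t : Fin n → ℝ) :
    ∑ j, ((σ j : ℤ) : ℝ) * t j
      = (∑ j ∈ Finset.univ.erase k, ((σ j : ℤ) : ℝ) * t j) + ((σ k : ℤ) : ℝ) * t k :=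
  (Finset.sum_erase_add _ _ (Finset.mem_univ k)).symm

lemma sum_flipSign_mul_eq (k : Fin n) (σ : Fin n → ℤˣ) (t : Fin n → ℝ) :
    ∑ j, ((flipSign k σ j : ℤ) : ℝ) * t j
      = (∑ j ∈ Finset.univ.erase k, ((σ j : ℤ) : ℝ) * t j) - ((σ k : ℤ) : ℝ) * t k := by
  rw [sum_sign_mul_eq k (flipSign k σ) t, sub_eq_add_neg]
  congr 1
  · refine Finset.sum_congr rfl fun j hj => ?_
    rw [flipSign, Function.update_of_ne (Finset.ne_of_mem_erase hj)]
  · simp [flipSign]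

/-- The two sign vectors which differ at `k` contribute `sup (A + u) + sup (A - u)`. -/
lemma iSup_add_iSup_flipSign {ι : Type*} (k : Fin n) (σ : Fin n → ℤˣ) (c : ℝ) (t : ι → Fin n → ℝ) :
    (⨆ i, c * ∑ j, ((σ j : ℤ) : ℝ) * t i j) + (⨆ i, c * ∑ j, ((flipSign k σ j : ℤ) : ℝ) * t i j)
      = (⨆ i, (c * ∑ j ∈ Finset.univ.erase k, ((σ j : ℤ) : ℝ) * t i j + c * t i k))
        + ⨆ i, (c * ∑ j ∈ Finset.univ.erase k, ((σ j : ℤ) : ℝ) * t i j - c * t i k) := by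
  simp_rw [sum_sign_mul_eq k σ, sum_flipSign_mul_eq k σ, mul_add, mul_sub]
  rcases sign_eq_one_or σ k with h | h
  · simp [h]
  · simp only [h, neg_mul, one_mul, mul_neg, sub_neg_eq_add]
    rw [add_comm]
    simp [sub_eq_add_neg]

lemma abs_sum_sign_mul_le {C : ℝ} (s : Finset (Fin n)) (σ : Fin n → ℤˣ) (t : Fin n → ℝ)
    (ht : ∀ j, |t j| ≤ C) : |∑ j ∈ s, ((σ j : ℤ) : ℝ) * t j| ≤ n * C := by
  have hC : 0 ≤ (n : ℝ) * C := by
    rcases Nat.eq_zero_or_pos n with h | h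
    · simp [h]
    · exact mul_nonneg n.cast_nonneg ((abs_nonneg _).trans (ht ⟨0, h⟩))
  refine (Finset.abs_sum_le_sum_abs _ _).trans ?_
  calc ∑ j ∈ s, |((σ j : ℤ) : ℝ) * t j| ≤ ∑ j : Fin n, |((σ j : ℤ) : ℝ) * t j| :=
        Finset.sum_le_sum_of_subset_of_nonneg (Finset.subset_univ s) fun _ _ _ => abs_nonneg _
    _ ≤ ∑ _j : Fin n, C := Finset.sum_le_sum fun j _ => by
        rw [abs_mul, abs_sign, one_mul]; exact ht j
    _ = n * C := by simp

lemma card_signs : (Fintype.card (Fin n → ℤˣ) : ℝ) = 2 ^ n := by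
  simp

end Signs

/-! ### Suprema of the empirical process and of its sign-weighted version. -/

section EmpiricalProcess

variable {X : Type*} [MeasurableSpace X] {ι : Type*} {n : ℕ}

/-- The largest deviation of the mean from the empirical mean over the class `h`. -/
noncomputable def maxDeviation (P : Measure X) (h : ι → X → ℝ) (x : Fin n → X) : ℝ :=
  ⨆ i, (∫ a, h i a ∂P - (1 / (n : ℝ)) * ∑ j, h i (x j))

/-- The supremum of the sign-weighted empirical sums over the class `h`. -/
noncomputable def signedSup (h : ι → X → ℝ) (σ : Fin n → ℤˣ) (x : Fin n → X) : ℝ :=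
  ⨆ i, (2 / (n : ℝ)) * ∑ j, ((σ j : ℤ) : ℝ) * h i (x j)

/-- The one-sided empirical Rademacher average of the class `h`. -/
noncomputable def rademacherAverage (h : ι → X → ℝ) (x : Fin n → X) : ℝ :=
  (∑ σ : Fin n → ℤˣ, signedSup h σ x) / 2 ^ n

variable {P : Measure X} [IsProbabilityMeasure P] {h : ι → X → ℝ}

lemma average_mem_Icc (hn : 1 ≤ n) {g : X → ℝ} (h0 : ∀ a, 0 ≤ g a) (h1 : ∀ a, g a ≤ 1)
    (x : Fin n → X) : (1 / (n : ℝ)) * ∑ j, g (x j) ∈ Set.Icc (0 : ℝ) 1 := by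
  have hn0 : (0 : ℝ) < n := by exact_mod_cast hn
  refine ⟨mul_nonneg (by positivity) (Finset.sum_nonneg fun j _ => h0 _), ?_⟩
  calc (1 / (n : ℝ)) * ∑ j, g (x j) ≤ (1 / (n : ℝ)) * ∑ _j : Fin n, (1 : ℝ) := by
        gcongr; exact h1 _
    _ = 1 := by simp; field_simp

lemma integral_mem_Icc {g : X → ℝ} (hg : Measurable g) (h0 : ∀ a, 0 ≤ g a) (h1 : ∀ a, g a ≤ 1) :
    ∫ a, g a ∂P ∈ Set.Icc (0 : ℝ) 1 := by
  refine ⟨integral_nonneg h0, ?_⟩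
  have hi : Integrable g P := Integrable.of_bound hg.aestronglyMeasurable 1
    (ae_of_all _ fun a => by rw [Real.norm_eq_abs, abs_of_nonneg (h0 a)]; exact h1 a)
  calc ∫ a, g a ∂P ≤ ∫ _a, (1 : ℝ) ∂P := integral_mono hi (integrable_const _) h1
    _ = 1 := by simp

lemma abs_deviation_le (hn : 1 ≤ n) (hm : ∀ i, Measurable (h i)) (h0 : ∀ i a, 0 ≤ h i a)
    (h1 : ∀ i a, h i a ≤ 1) (x : Fin n → X) (i : ι) :
    |∫ a, h i a ∂P - (1 / (n : ℝ)) * ∑ j, h i (x j)| ≤ 1 := by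
  have a1 := average_mem_Icc hn (h0 i) (h1 i) x
  have a2 := integral_mem_Icc (P := P) (hm i) (h0 i) (h1 i)
  exact abs_le.2 ⟨by linarith [a1.2, a2.1], by linarith [a1.1, a2.2]⟩

lemma bddAbove_deviation (hn : 1 ≤ n) (hm : ∀ i, Measurable (h i)) (h0 : ∀ i a, 0 ≤ h i a)
    (h1 : ∀ i a, h i a ≤ 1) (x : Fin n → X) :
    BddAbove (Set.range fun i => ∫ a, h i a ∂P - (1 / (n : ℝ)) * ∑ j, h i (x j)) :=
  ⟨1, by rintro _ ⟨i, rfl⟩; exact (abs_le.1 (abs_deviation_le hn hm h0 h1 x i)).2⟩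

lemma abs_iSup_le [Nonempty ι] {g : ι → ℝ} {C : ℝ} (hg : ∀ i, |g i| ≤ C) : |⨆ i, g i| ≤ C := by
  have hb : BddAbove (Set.range g) := ⟨C, by rintro _ ⟨i, rfl⟩; exact (abs_le.1 (hg i)).2⟩
  refine abs_le.2 ⟨?_, ciSup_le fun i => (abs_le.1 (hg i)).2⟩
  obtain ⟨i⟩ := ‹Nonempty ι›
  exact (abs_le.1 (hg i)).1.trans (le_ciSup hb i)

lemma iSup_le_iSup_add [Nonempty ι] {g g' : ι → ℝ} {C c : ℝ} (hg' : ∀ i, |g' i| ≤ C)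
    (hgg : ∀ i, g i ≤ g' i + c) : ⨆ i, g i ≤ (⨆ i, g' i) + c := by
  have hb : BddAbove (Set.range g') := ⟨C, by rintro _ ⟨i, rfl⟩; exact (abs_le.1 (hg' i)).2⟩
  exact ciSup_le fun i => (hgg i).trans (by linarith [le_ciSup hb i])

lemma abs_maxDeviation_le [Nonempty ι] (hn : 1 ≤ n) (hm : ∀ i, Measurable (h i))
    (h0 : ∀ i a, 0 ≤ h i a) (h1 : ∀ i a, h i a ≤ 1) (x : Fin n → X) :
    |maxDeviation P h x| ≤ 1 :=
  abs_iSup_le fun i => abs_deviation_le hn hm h0 h1 x i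

lemma abs_signed_le (hn : 1 ≤ n) (h0 : ∀ i a, 0 ≤ h i a) (h1 : ∀ i a, h i a ≤ 1)
    (σ : Fin n → ℤˣ) (x : Fin n → X) (s : Finset (Fin n)) (i : ι) :
    |(2 / (n : ℝ)) * ∑ j ∈ s, ((σ j : ℤ) : ℝ) * h i (x j)| ≤ 2 := by
  have hn0 : (0 : ℝ) < n := by exact_mod_cast hn
  have := abs_sum_sign_mul_le s σ (fun j => h i (x j)) (C := 1) fun j => by
    rw [abs_of_nonneg (h0 _ _)]; exact h1 _ _
  rw [abs_mul, abs_of_pos (by positivity)]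
  calc (2 / (n : ℝ)) * |∑ j ∈ s, ((σ j : ℤ) : ℝ) * h i (x j)| ≤ (2 / n) * (n * 1) := by gcongr
    _ = 2 := by field_simp

lemma abs_signedSup_le [Nonempty ι] (hn : 1 ≤ n) (h0 : ∀ i a, 0 ≤ h i a) (h1 : ∀ i a, h i a ≤ 1)
    (σ : Fin n → ℤˣ) (x : Fin n → X) : |signedSup h σ x| ≤ 2 :=
  abs_iSup_le fun i => abs_signed_le hn h0 h1 σ x _ i

lemma abs_rademacherAverage_le [Nonempty ι] (hn : 1 ≤ n) (h0 : ∀ i a, 0 ≤ h i a)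
    (h1 : ∀ i a, h i a ≤ 1) (x : Fin n → X) : |rademacherAverage h x| ≤ 2 := by
  rw [rademacherAverage, abs_div, abs_of_pos (by positivity : (0 : ℝ) < 2 ^ n),
    div_le_iff₀ (by positivity)]
  refine (Finset.abs_sum_le_sum_abs _ _).trans ?_
  calc ∑ σ : Fin n → ℤˣ, |signedSup h σ x| ≤ ∑ _σ : Fin n → ℤˣ, (2 : ℝ) :=
        Finset.sum_le_sum fun σ _ => abs_signedSup_le hn h0 h1 σ x
    _ = 2 * 2 ^ n := by rw [Finset.sum_const, nsmul_eq_mul, Finset.card_univ, card_signs]; ring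

lemma measurable_maxDeviation [Countable ι] (hm : ∀ i, Measurable (h i)) :
    Measurable fun x : Fin n → X => maxDeviation P h x :=
  Measurable.iSup fun i => measurable_const.sub <| measurable_const.mul <|
    Finset.measurable_sum _ fun j _ => (hm i).comp (measurable_pi_apply j)

lemma measurable_signedSup [Countable ι] (hm : ∀ i, Measurable (h i)) (σ : Fin n → ℤˣ) :
    Measurable fun x : Fin n → X => signedSup h σ x :=
  Measurable.iSup fun i => measurable_const.mul <|
    Finset.measurable_sum _ fun j _ => measurable_const.mul ((hm i).comp (measurable_pi_apply j))

lemma measurable_rademacherAverage [Countable ι] (hm : ∀ i, Measurable (h i)) :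
    Measurable fun x : Fin n → X => rademacherAverage h x :=
  (Finset.measurable_sum _ fun σ _ => measurable_signedSup hm σ).div_const _

lemma maxDeviation_bounded_differences [Nonempty ι] (hn : 1 ≤ n) (hm : ∀ i, Measurable (h i))
    (h0 : ∀ i a, 0 ≤ h i a) (h1 : ∀ i a, h i a ≤ 1) (x : Fin n → X) (k : Fin n) (a : X) :
    |maxDeviation P h x - maxDeviation P h (Function.update x k a)| ≤ 1 / n := by
  have hn0 : (0 : ℝ) < n := by exact_mod_cast hn
  have key : ∀ (x : Fin n → X) (a : X),
      maxDeviation P h x ≤ maxDeviation P h (Function.update x k a) + 1 / n := fun x a => by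
    refine iSup_le_iSup_add (C := 1) (fun i => abs_deviation_le hn hm h0 h1 _ i) fun i => ?_
    rw [← Finset.sum_erase_add _ _ (Finset.mem_univ k),
      ← Finset.sum_erase_add _ (fun j => h i (Function.update x k a j)) (Finset.mem_univ k)]
    have : ∑ j ∈ Finset.univ.erase k, h i (Function.update x k a j)
        = ∑ j ∈ Finset.univ.erase k, h i (x j) := Finset.sum_congr rfl fun j hj => by
      rw [Function.update_of_ne (Finset.ne_of_mem_erase hj)]
    rw [this, Function.update_self]
    have hp : (0 : ℝ) < 1 / n := by positivity
    nlinarith [h0 i (x k), h1 i a]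
  refine abs_le.2 ⟨?_, by linarith [key x a]⟩
  have := key (Function.update x k a) (x k)
  rw [Function.update_idem, Function.update_eq_self] at this
  linarith

/-- The constant is `1/n` although each sign vector has weight `2/n`. Pairing `σ` with its flip at
`k` gives `sup (A + u) + sup (A - u)` with `0 ≤ u ≤ 2/n` and `A` independent of the changed point.
This lies between `2 sup A` and `2 sup A + 2/n`, so the average over the pair moves by at most
`1/n`. -/
lemma rademacherAverage_bounded_differences [Nonempty ι] (hn : 1 ≤ n)
    (h0 : ∀ i a, 0 ≤ h i a) (h1 : ∀ i a, h i a ≤ 1) (x : Fin n → X) (k : Fin n) (a : X) :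
    |rademacherAverage h x - rademacherAverage h (Function.update x k a)| ≤ 1 / n := by
  have hn0 : (0 : ℝ) < n := by exact_mod_cast hn
  have key : ∀ (x : Fin n → X) (a : X),
      rademacherAverage h x ≤ rademacherAverage h (Function.update x k a) + 1 / n := fun x a => by
    have hpair : ∀ σ : Fin n → ℤˣ, signedSup h σ x + signedSup h (flipSign k σ) x
        ≤ (signedSup h σ (Function.update x k a) + signedSup h (flipSign k σ) (Function.update x k a))
          + 2 / n := fun σ => by
      have e1 := iSup_add_iSup_flipSign k σ (2 / (n : ℝ)) fun i j => h i (x j)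
      have e2 := iSup_add_iSup_flipSign k σ (2 / (n : ℝ)) fun i j => h i (Function.update x k a j)
      simp only [signedSup]
      rw [e1, e2]
      have hA : ∀ i, ∑ j ∈ Finset.univ.erase k, ((σ j : ℤ) : ℝ) * h i (Function.update x k a j)
          = ∑ j ∈ Finset.univ.erase k, ((σ j : ℤ) : ℝ) * h i (x j) := fun i =>
        Finset.sum_congr rfl fun j hj => by
          rw [Function.update_of_ne (Finset.ne_of_mem_erase hj)]
      simp_rw [hA, Function.update_self]
      set A : ι → ℝ := fun i => 2 / (n : ℝ) * ∑ j ∈ Finset.univ.erase k, ((σ j : ℤ) : ℝ) * h i (x j)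
      have hAb : ∀ i, |A i| ≤ 2 := fun i => abs_signed_le hn h0 h1 σ x _ i
      have h2n : (2 : ℝ) / n ≤ 2 := div_le_self (by norm_num) (by exact_mod_cast hn)
      have h2p : (0 : ℝ) < 2 / n := by positivity
      have hu : ∀ i b, 0 ≤ 2 / (n : ℝ) * h i b ∧ 2 / (n : ℝ) * h i b ≤ 2 / n := fun i b =>
        ⟨mul_nonneg h2p.le (h0 i b), by nlinarith [h1 i b]⟩
      have up1 : ⨆ i, (A i + 2 / (n : ℝ) * h i (x k)) ≤ (⨆ i, A i) + 2 / n :=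
        iSup_le_iSup_add hAb fun i => by linarith [(hu i (x k)).2]
      have up2 : ⨆ i, (A i - 2 / (n : ℝ) * h i (x k)) ≤ (⨆ i, A i) + 0 :=
        iSup_le_iSup_add hAb fun i => by linarith [(hu i (x k)).1]
      have hb1 : BddAbove (Set.range fun i => A i + 2 / (n : ℝ) * h i a) :=
        ⟨4, by rintro _ ⟨i, rfl⟩; linarith [(abs_le.1 (hAb i)).2, (hu i a).2]⟩
      have hb2 : BddAbove (Set.range fun i => A i - 2 / (n : ℝ) * h i a) :=
        ⟨4, by rintro _ ⟨i, rfl⟩; linarith [(abs_le.1 (hAb i)).2, (hu i a).1]⟩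
      have low : ⨆ i, A i ≤ ((⨆ i, (A i + 2 / (n : ℝ) * h i a))
          + ⨆ i, (A i - 2 / (n : ℝ) * h i a)) / 2 :=
        ciSup_le fun i => by linarith [le_ciSup hb1 i, le_ciSup hb2 i]
      linarith
    have hs := Finset.sum_le_sum fun (σ : Fin n → ℤˣ) (_ : σ ∈ Finset.univ) => hpair σ
    rw [← sum_flipSign k fun σ => signedSup h σ x, Finset.sum_add_distrib,
      ← sum_flipSign k fun σ => signedSup h σ (Function.update x k a), Finset.sum_const, nsmul_eq_mul,
      Finset.card_univ, card_signs] at hs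
    have h2 : (0 : ℝ) < 2 ^ n := by positivity
    rw [rademacherAverage, rademacherAverage, div_le_iff₀ h2, add_mul, div_mul_cancel₀ _ h2.ne']
    have e : (2 : ℝ) ^ n * (2 / n) = 2 * (1 / n * 2 ^ n) := by ring
    linarith
  refine abs_le.2 ⟨?_, by linarith [key x a]⟩
  have := key (Function.update x k a) (x k)
  rw [Function.update_idem, Function.update_eq_self] at this
  linarith

end EmpiricalProcess

/-! ### Symmetrization by a ghost sample. -/

section Symmetrization

variable {X : Type*} [MeasurableSpace X] {ι : Type*} {n : ℕ}

/-- The supremum of the sign-weighted sums of differences over a sample of pairs. -/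
noncomputable def pairedSup (h : ι → X → ℝ) (σ : Fin n → ℤˣ) (z : Fin n → X × X) : ℝ :=
  ⨆ i, (1 / (n : ℝ)) * ∑ j, ((σ j : ℤ) : ℝ) * (h i (z j).2 - h i (z j).1)

variable {P : Measure X} [IsProbabilityMeasure P] {h : ι → X → ℝ}

lemma abs_paired_le (hn : 1 ≤ n) (h0 : ∀ i a, 0 ≤ h i a) (h1 : ∀ i a, h i a ≤ 1)
    (σ : Fin n → ℤˣ) (z : Fin n → X × X) (i : ι) :
    |(1 / (n : ℝ)) * ∑ j, ((σ j : ℤ) : ℝ) * (h i (z j).2 - h i (z j).1)| ≤ 1 := by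
  have hn0 : (0 : ℝ) < n := by exact_mod_cast hn
  have := abs_sum_sign_mul_le Finset.univ σ (fun j => h i (z j).2 - h i (z j).1) (C := 1) fun j =>
    abs_le.2 ⟨by linarith [h0 i (z j).2, h1 i (z j).1], by linarith [h1 i (z j).2, h0 i (z j).1]⟩
  rw [abs_mul, abs_of_pos (by positivity)]
  calc (1 / (n : ℝ)) * |∑ j, ((σ j : ℤ) : ℝ) * (h i (z j).2 - h i (z j).1)|
      ≤ (1 / n) * (n * 1) := by gcongr
    _ = 1 := by field_simp

lemma measurable_pairedSup [Countable ι] (hm : ∀ i, Measurable (h i)) (σ : Fin n → ℤˣ) :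
    Measurable fun z : Fin n → X × X => pairedSup h σ z :=
  Measurable.iSup fun i => measurable_const.mul <| Finset.measurable_sum _ fun j _ =>
    measurable_const.mul <| ((hm i).comp (measurable_snd.comp (measurable_pi_apply j))).sub
      ((hm i).comp (measurable_fst.comp (measurable_pi_apply j)))

lemma integrable_pairedSup [Countable ι] [Nonempty ι] (hn : 1 ≤ n) (hm : ∀ i, Measurable (h i))
    (h0 : ∀ i a, 0 ≤ h i a) (h1 : ∀ i a, h i a ≤ 1) (σ : Fin n → ℤˣ)
    (Q : Measure (Fin n → X × X)) [IsFiniteMeasure Q] : Integrable (pairedSup h σ) Q :=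
  Integrable.of_bound (measurable_pairedSup hm σ).aestronglyMeasurable 1
    (ae_of_all _ fun z => abs_iSup_le fun i => abs_paired_le hn h0 h1 σ z i)

/-- Swapping the two elements of some of the pairs does not change the distribution. -/
lemma integral_pairedSup_eq [Countable ι] (hm : ∀ i, Measurable (h i)) (σ : Fin n → ℤˣ) :
    ∫ z, pairedSup h σ z ∂(Measure.pi fun _ : Fin n => P.prod P)
      = ∫ z, pairedSup h (1 : Fin n → ℤˣ) z ∂(Measure.pi fun _ : Fin n => P.prod P) := by
  set f : Fin n → X × X → X × X := fun j => if σ j = 1 then id else Prod.swap with hf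
  have hmp : MeasurePreserving (fun (z : Fin n → X × X) j => f j (z j))
      (Measure.pi fun _ => P.prod P) (Measure.pi fun _ => P.prod P) := by
    refine measurePreserving_pi _ _ fun j => ?_
    by_cases hj : σ j = 1
    · simpa [hf, hj] using MeasurePreserving.id (P.prod P)
    · simpa [hf, hj] using Measure.measurePreserving_swap (μ := P) (ν := P)
  have hcomp : ∀ z : Fin n → X × X, pairedSup h 1 (fun j => f j (z j)) = pairedSup h σ z :=
    fun z => by
      simp only [pairedSup]
      refine congrArg iSup (funext fun i => congrArg _ (Finset.sum_congr rfl fun j _ => ?_))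
      rcases Int.units_eq_one_or (σ j) with hj | hj <;> simp [hf, hj]
  rw [← hmp.map_eq, integral_map hmp.measurable.aemeasurable
    (measurable_pairedSup hm 1).aestronglyMeasurable, hmp.map_eq]
  simp_rw [hcomp]

/-- The mean of `h i` is the expected empirical mean over an independent ghost sample, and a
supremum of expectations is at most the expectation of the supremum. -/
lemma integral_maxDeviation_le_paired [Countable ι] [Nonempty ι] (hn : 1 ≤ n)
    (hm : ∀ i, Measurable (h i)) (h0 : ∀ i a, 0 ≤ h i a) (h1 : ∀ i a, h i a ≤ 1) :
    ∫ x, maxDeviation P h x ∂(Measure.pi fun _ : Fin n => P)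
      ≤ ∫ z, pairedSup h 1 z ∂(Measure.pi fun _ : Fin n => P.prod P) := by
  set μ := Measure.pi fun _ : Fin n => P
  have hmp := measurePreserving_arrowProdEquivProdArrow X X (Fin n) (fun _ => P) (fun _ => P)
  set G : (Fin n → X) × (Fin n → X) → ℝ := fun p => pairedSup h 1 fun j => (p.1 j, p.2 j)
  have hGm : Measurable G := (measurable_pairedSup hm 1).comp <| measurable_pi_iff.2 fun j =>
    ((measurable_pi_apply j).comp measurable_fst).prodMk ((measurable_pi_apply j).comp measurable_snd)
  have hGb : ∀ p, |G p| ≤ 1 := fun p => abs_iSup_le fun i => abs_paired_le hn h0 h1 1 _ i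
  have hGi : Integrable G (μ.prod μ) :=
    Integrable.of_bound hGm.aestronglyMeasurable 1 (ae_of_all _ hGb)
  have e : ∫ z, pairedSup h 1 z ∂(Measure.pi fun _ : Fin n => P.prod P)
      = ∫ x, ∫ x', G (x, x') ∂μ ∂μ := by
    rw [← integral_prod _ hGi, ← hmp.integral_comp (MeasurableEquiv.measurableEmbedding _)]
    rfl
  rw [e]
  refine integral_mono (Integrable.of_bound (measurable_maxDeviation hm).aestronglyMeasurable 1
    (ae_of_all _ fun x => abs_maxDeviation_le hn hm h0 h1 x)) hGi.integral_prod_left fun x => ?_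
  refine ciSup_le fun i => ?_
  have hhi : Integrable (h i) P := Integrable.of_bound (hm i).aestronglyMeasurable 1
    (ae_of_all _ fun a => by rw [Real.norm_eq_abs, abs_of_nonneg (h0 i a)]; exact h1 i a)
  have heval : ∀ j : Fin n, Integrable (fun x' : Fin n → X => h i (x' j)) μ ∧
      ∫ x', h i (x' j) ∂μ = ∫ a, h i a ∂P := fun j => by
    have hp := measurePreserving_eval (fun _ : Fin n => P) j
    refine ⟨hp.integrable_comp_of_integrable hhi, ?_⟩
    rw [← hp.map_eq, integral_map hp.measurable.aemeasurable
      (by rw [hp.map_eq]; exact (hm i).aestronglyMeasurable)]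
  have hn0 : (0 : ℝ) < n := by exact_mod_cast hn
  have hval : ∫ a, h i a ∂P - (1 / (n : ℝ)) * ∑ j, h i (x j)
      = ∫ x', (1 / (n : ℝ)) * ∑ j, ((((1 : Fin n → ℤˣ) j : ℤ) : ℝ) * (h i (x' j) - h i (x j))) ∂μ := by
    rw [integral_const_mul]
    simp only [Pi.one_apply, Units.val_one, Int.cast_one, one_mul]
    have hs : ∫ x', ∑ j, (h i (x' j) - h i (x j)) ∂μ = ∑ j, ∫ x', (h i (x' j) - h i (x j)) ∂μ :=
      integral_finsetSum _ fun j _ => (heval j).1.sub (integrable_const _)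
    rw [hs]
    have : ∀ j, ∫ x', (h i (x' j) - h i (x j)) ∂μ = ∫ a, h i a ∂P - h i (x j) := fun j => by
      rw [integral_sub (heval j).1 (integrable_const _), (heval j).2]; simp
    simp_rw [this]
    rw [Finset.sum_sub_distrib]
    simp
    field_simp
  rw [hval]
  have hb : ∀ x' : Fin n → X, BddAbove (Set.range fun i => (1 / (n : ℝ)) *
      ∑ j, ((((1 : Fin n → ℤˣ) j : ℤ) : ℝ) * (h i (x' j) - h i (x j)))) := fun x' =>
    ⟨1, by
      rintro _ ⟨i, rfl⟩
      exact (abs_le.1 (abs_paired_le hn h0 h1 1 (fun j => (x j, x' j)) i)).2⟩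
  refine integral_mono ?_ ?_ fun x' => le_ciSup (hb x') i
  · refine Integrable.const_mul (integrable_finsetSum _ fun j _ => Integrable.const_mul ?_ _) _
    exact (heval j).1.sub (integrable_const _)
  · exact Integrable.of_bound (hGm.comp (measurable_const.prodMk measurable_id)).aestronglyMeasurable
      1 (ae_of_all _ fun x' => hGb _)

/-- **Symmetrization**: the expected maximal deviation is at most the expected one-sided
Rademacher average. -/
theorem integral_maxDeviation_le [Countable ι] [Nonempty ι] (hn : 1 ≤ n)
    (hm : ∀ i, Measurable (h i)) (h0 : ∀ i a, 0 ≤ h i a) (h1 : ∀ i a, h i a ≤ 1) :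
    ∫ x, maxDeviation P h x ∂(Measure.pi fun _ : Fin n => P)
      ≤ ∫ x, rademacherAverage h x ∂(Measure.pi fun _ : Fin n => P) := by
  refine (integral_maxDeviation_le_paired hn hm h0 h1).trans ?_
  set μ := Measure.pi fun _ : Fin n => P
  set Q := Measure.pi fun _ : Fin n => P.prod P
  have hn0 : (0 : ℝ) < n := by exact_mod_cast hn
  have hfst : MeasurePreserving (fun (z : Fin n → X × X) j => (z j).1) Q μ :=
    measurePreserving_pi _ _ fun _ => measurePreserving_fst
  have hsnd : MeasurePreserving (fun (z : Fin n → X × X) j => (z j).2) Q μ :=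
    measurePreserving_pi _ _ fun _ => measurePreserving_snd
  have hint : ∀ σ : Fin n → ℤˣ, Integrable (signedSup h σ) μ := fun σ =>
    Integrable.of_bound (measurable_signedSup hm σ).aestronglyMeasurable 2
      (ae_of_all _ fun x => abs_signedSup_le hn h0 h1 σ x)
  have hcomp : ∀ (φ : (Fin n → X × X) → Fin n → X), MeasurePreserving φ Q μ → ∀ σ : Fin n → ℤˣ,
      Integrable (fun z => signedSup h σ (φ z)) Q ∧
      ∫ z, signedSup h σ (φ z) ∂Q = ∫ x, signedSup h σ x ∂μ := fun φ hφ σ => by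
    refine ⟨hφ.integrable_comp_of_integrable (hint σ), ?_⟩
    rw [← hφ.map_eq, integral_map hφ.measurable.aemeasurable
      (measurable_signedSup hm σ).aestronglyMeasurable]
  -- The supremum of the difference splits into one supremum per half of the pairs; the minus sign
  -- turns `σ` into `-σ`, which disappears on summing over all `σ`.
  have hstep : ∀ σ : Fin n → ℤˣ, 2 * ∫ z, pairedSup h 1 z ∂Q
      ≤ ∫ x, signedSup h σ x ∂μ + ∫ x, signedSup h (-σ) x ∂μ := fun σ => by
    rw [← integral_pairedSup_eq hm σ, ← (hcomp _ hsnd σ).2, ← (hcomp _ hfst (-σ)).2,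
      ← integral_const_mul, ← integral_add (hcomp _ hsnd σ).1 (hcomp _ hfst (-σ)).1]
    refine integral_mono ((integrable_pairedSup hn hm h0 h1 σ Q).const_mul 2)
      ((hcomp _ hsnd σ).1.add (hcomp _ hfst (-σ)).1) fun z => ?_
    have hb : ∀ (τ : Fin n → ℤˣ) (x : Fin n → X), BddAbove (Set.range fun i =>
        (2 / (n : ℝ)) * ∑ j, ((τ j : ℤ) : ℝ) * h i (x j)) := fun τ x =>
      ⟨2, by rintro _ ⟨i, rfl⟩; exact (abs_le.1 (abs_signed_le hn h0 h1 τ x _ i)).2⟩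
    have : pairedSup h σ z ≤ (signedSup h σ (fun j => (z j).2) + signedSup h (-σ) (fun j => (z j).1))
        / 2 := ciSup_le fun i => by
      have a1 := le_ciSup (hb σ fun j => (z j).2) i
      have a2 := le_ciSup (hb (-σ) fun j => (z j).1) i
      have e : (1 / (n : ℝ)) * ∑ j, ((σ j : ℤ) : ℝ) * (h i (z j).2 - h i (z j).1)
          = ((2 / (n : ℝ)) * ∑ j, ((σ j : ℤ) : ℝ) * h i (z j).2
            + (2 / (n : ℝ)) * ∑ j, (((-σ) j : ℤ) : ℝ) * h i (z j).1) / 2 := by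
        simp only [mul_sub, Finset.sum_sub_distrib, Pi.neg_apply, Units.val_neg, Int.cast_neg,
          neg_mul, Finset.sum_neg_distrib]
        ring
      rw [e]
      simp only [signedSup]
      linarith
    simp only
    linarith
  have hR : ∫ x, rademacherAverage h x ∂μ = (∑ σ : Fin n → ℤˣ, ∫ x, signedSup h σ x ∂μ) / 2 ^ n := by
    simp only [rademacherAverage]
    rw [integral_div, integral_finsetSum _ fun σ _ => hint σ]
  have hneg : ∑ σ : Fin n → ℤˣ, ∫ x, signedSup h (-σ) x ∂μ
      = ∑ σ : Fin n → ℤˣ, ∫ x, signedSup h σ x ∂μ :=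
    Equiv.sum_comp (Equiv.neg (Fin n → ℤˣ)) fun σ => ∫ x, signedSup h σ x ∂μ
  have hs := Finset.sum_le_sum fun (σ : Fin n → ℤˣ) (_ : σ ∈ Finset.univ) => hstep σ
  rw [Finset.sum_const, nsmul_eq_mul, Finset.card_univ, card_signs, Finset.sum_add_distrib, hneg] at hs
  rw [hR, le_div_iff₀ (by positivity)]
  linarith

end Symmetrization

/-! ### Contraction for one-sided Rademacher sums. -/

section Contraction

variable {ι : Type*} {n : ℕ}

lemma iSup_add_iSup_contraction [Nonempty ι] {A u v : ι → ℝ} {C : ℝ} (hA : ∀ i, |A i| ≤ C)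
    (hu : ∀ i, |u i| ≤ C) (huv : ∀ i i', |v i - v i'| ≤ |u i - u i'|) :
    (⨆ i, (A i + v i)) + ⨆ i, (A i - v i) ≤ (⨆ i, (A i + u i)) + ⨆ i, (A i - u i) := by
  have hb1 : BddAbove (Set.range fun i => A i + u i) := ⟨C + C, by
    rintro _ ⟨i, rfl⟩; linarith [(abs_le.1 (hA i)).2, (abs_le.1 (hu i)).2]⟩
  have hb2 : BddAbove (Set.range fun i => A i - u i) := ⟨C + C, by
    rintro _ ⟨i, rfl⟩; linarith [(abs_le.1 (hA i)).2, (abs_le.1 (hu i)).1]⟩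
  -- The sign of `u i - u i'` decides which of the two indices is used in the supremum with `+u` and
  -- which in the one with `-u`.
  have key : ∀ i i', (A i + v i) + (A i' - v i') ≤ (⨆ i, (A i + u i)) + ⨆ i, (A i - u i) := by
    intro i i'
    have h1 := (le_abs_self _).trans (huv i i')
    rcases abs_cases (u i - u i') with ⟨h, -⟩ | ⟨h, -⟩
    · have := le_ciSup hb1 i
      have := le_ciSup hb2 i'
      linarith
    · have := le_ciSup hb1 i'
      have := le_ciSup hb2 i
      linarith
  rw [← le_sub_iff_add_le]
  refine ciSup_le fun i => ?_
  rw [le_sub_comm]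
  exact ciSup_le fun i' => by linarith [key i i']

/-- **Contraction principle** for one-sided Rademacher averages. -/
theorem sum_iSup_contraction [Nonempty ι] {t s : ι → Fin n → ℝ} {C : ℝ} (ht : ∀ i j, |t i j| ≤ C)
    (hs : ∀ i j, |s i j| ≤ C) (hst : ∀ i i' j, |s i j - s i' j| ≤ |t i j - t i' j|) {c : ℝ}
    (hc : 0 ≤ c) :
    ∑ σ : Fin n → ℤˣ, ⨆ i, c * ∑ j, ((σ j : ℤ) : ℝ) * s i j
      ≤ ∑ σ : Fin n → ℤˣ, ⨆ i, c * ∑ j, ((σ j : ℤ) : ℝ) * t i j := by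
  classical
  -- Coordinates are contracted one at a time: `S` is the set already replaced, and pairing sign
  -- vectors that differ at the new coordinate reduces to two suprema.
  suffices H : ∀ S : Finset (Fin n),
      ∑ σ : Fin n → ℤˣ, ⨆ i, c * ∑ j, ((σ j : ℤ) : ℝ) * (if j ∈ S then s i j else t i j)
        ≤ ∑ σ : Fin n → ℤˣ, ⨆ i, c * ∑ j, ((σ j : ℤ) : ℝ) * t i j by
    simpa using H Finset.univ
  intro S
  induction S using Finset.induction_on with
  | empty => simp
  | insert k S hk ih =>
    refine le_trans ?_ ih
    have hpair : ∀ σ : Fin n → ℤˣ,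
        (⨆ i, c * ∑ j, ((σ j : ℤ) : ℝ) * (if j ∈ insert k S then s i j else t i j))
          + (⨆ i, c * ∑ j, ((flipSign k σ j : ℤ) : ℝ) * (if j ∈ insert k S then s i j else t i j))
        ≤ (⨆ i, c * ∑ j, ((σ j : ℤ) : ℝ) * (if j ∈ S then s i j else t i j))
          + (⨆ i, c * ∑ j, ((flipSign k σ j : ℤ) : ℝ) * (if j ∈ S then s i j else t i j)) := fun σ => by
      rw [iSup_add_iSup_flipSign k σ c fun i j => if j ∈ insert k S then s i j else t i j,
        iSup_add_iSup_flipSign k σ c fun i j => if j ∈ S then s i j else t i j]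
      have e : ∀ i, ∑ j ∈ Finset.univ.erase k, ((σ j : ℤ) : ℝ) * (if j ∈ insert k S then s i j else t i j)
          = ∑ j ∈ Finset.univ.erase k, ((σ j : ℤ) : ℝ) * (if j ∈ S then s i j else t i j) := fun i =>
        Finset.sum_congr rfl fun j hj => by simp [Finset.mem_insert, Finset.ne_of_mem_erase hj]
      simp only [e, Finset.mem_insert_self, if_true, hk, if_false]
      have hq : ∀ i, |c * ∑ j ∈ Finset.univ.erase k, ((σ j : ℤ) : ℝ) * (if j ∈ S then s i j else t i j)|
          ≤ c * (n * C) := fun i => by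
        rw [abs_mul, abs_of_nonneg hc]
        refine mul_le_mul_of_nonneg_left (abs_sum_sign_mul_le _ σ _ fun j => ?_) hc
        split_ifs
        · exact hs i j
        · exact ht i j
      refine iSup_add_iSup_contraction (C := max (c * (n * C)) (c * C))
        (fun i => (hq i).trans (le_max_left _ _)) (fun i => ?_) fun i i' => ?_
      · rw [abs_mul, abs_of_nonneg hc]
        exact (mul_le_mul_of_nonneg_left (ht i k) hc).trans (le_max_right _ _)
      · rw [← mul_sub, ← mul_sub, abs_mul, abs_mul]
        exact mul_le_mul_of_nonneg_left (hst i i' k) (abs_nonneg c)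
    have hsum := Finset.sum_le_sum fun (σ : Fin n → ℤˣ) (_ : σ ∈ Finset.univ) => hpair σ
    rw [← sum_flipSign k fun σ => ⨆ i, c * ∑ j, ((σ j : ℤ) : ℝ) *
        (if j ∈ insert k S then s i j else t i j),
      ← sum_flipSign k fun σ => ⨆ i, c * ∑ j, ((σ j : ℤ) : ℝ) * (if j ∈ S then s i j else t i j)]
      at hsum
    linarith

end Contraction

/-! ### Moments of Rademacher sums and a Khinchine-type lower bound. -/

section SignSums

variable {n : ℕ}

/-- The sum of the signs. -/
def signSum (σ : Fin n → ℤˣ) : ℝ := ∑ j, ((σ j : ℤ) : ℝ)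

lemma sum_signs_succ (G : ℝ → ℝ) :
    ∑ σ : Fin (n + 1) → ℤˣ, G (signSum σ)
      = ∑ σ : Fin n → ℤˣ, (G (signSum σ + 1) + G (signSum σ - 1)) := by
  rw [← (Fin.consEquiv fun _ : Fin (n + 1) => ℤˣ).sum_comp, Fintype.sum_prod_type_right]
  refine Finset.sum_congr rfl fun σ _ => ?_
  have : ∀ ε : ℤˣ, signSum (Fin.consEquiv (fun _ : Fin (n + 1) => ℤˣ) (ε, σ))
      = signSum σ + ((ε : ℤ) : ℝ) := fun ε => by
    simp [signSum, Fin.sum_univ_succ, Fin.consEquiv, add_comm]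
  simp_rw [this]
  have hu : (Finset.univ : Finset ℤˣ) = {1, -1} := by decide
  rw [hu, Finset.sum_pair (by decide)]
  simp [sub_eq_add_neg]

lemma sum_signSum_sq (n : ℕ) : ∑ σ : Fin n → ℤˣ, signSum σ ^ 2 = n * 2 ^ n := by
  induction n with
  | zero => simp [signSum]
  | succ n ih =>
    rw [sum_signs_succ fun t => t ^ 2]
    have : ∀ σ : Fin n → ℤˣ, (signSum σ + 1) ^ 2 + (signSum σ - 1) ^ 2 = 2 * signSum σ ^ 2 + 2 :=
      fun σ => by ring
    simp_rw [this]
    rw [Finset.sum_add_distrib, ← Finset.mul_sum, ih, Finset.sum_const, nsmul_eq_mul,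
      Finset.card_univ, card_signs]
    push_cast
    ring

lemma sum_signSum_pow_four (n : ℕ) :
    ∑ σ : Fin n → ℤˣ, signSum σ ^ 4 = (3 * n ^ 2 - 2 * n) * 2 ^ n := by
  induction n with
  | zero => simp [signSum]
  | succ n ih =>
    rw [sum_signs_succ fun t => t ^ 4]
    have : ∀ σ : Fin n → ℤˣ, (signSum σ + 1) ^ 4 + (signSum σ - 1) ^ 4
        = 2 * signSum σ ^ 4 + 12 * signSum σ ^ 2 + 2 := fun σ => by ring
    simp_rw [this]
    rw [Finset.sum_add_distrib, Finset.sum_add_distrib, ← Finset.mul_sum, ← Finset.mul_sum, ih,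
      sum_signSum_sq, Finset.sum_const, nsmul_eq_mul, Finset.card_univ, card_signs]
    push_cast
    ring

lemma sum_signSum (n : ℕ) : ∑ σ : Fin n → ℤˣ, signSum σ = 0 := by
  have h := Equiv.sum_comp (Equiv.neg (Fin n → ℤˣ)) fun σ => signSum σ
  have hn : ∀ σ : Fin n → ℤˣ, signSum (Equiv.neg _ σ) = -signSum σ := fun σ => by
    simp [signSum]
  simp_rw [hn, Finset.sum_neg_distrib] at h
  linarith

lemma sum_abs_signSum_le (hn : 1 ≤ n) : ∑ σ : Fin n → ℤˣ, |signSum σ| ≤ √n * 2 ^ n := by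
  have hn0 : (0 : ℝ) < n := by exact_mod_cast hn
  have hs : 0 < √(n : ℝ) := Real.sqrt_pos.2 hn0
  have hss : √(n : ℝ) ^ 2 = n := Real.sq_sqrt hn0.le
  have : ∀ σ : Fin n → ℤˣ, 2 * √n * |signSum σ| ≤ signSum σ ^ 2 + n := fun σ => by
    nlinarith [sq_nonneg (|signSum σ| - √n), sq_abs (signSum σ)]
  have h := Finset.sum_le_sum fun (σ : Fin n → ℤˣ) (_ : σ ∈ Finset.univ) => this σ
  rw [← Finset.mul_sum, Finset.sum_add_distrib, sum_signSum_sq, Finset.sum_const, nsmul_eq_mul,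
    Finset.card_univ, card_signs] at h
  refine le_of_mul_le_mul_left (h.trans_eq ?_) (by positivity : 0 < 2 * √(n : ℝ))
  linear_combination (-2 * 2 ^ n : ℝ) * hss

/-- The even quartic touches `|x|` at `|x| = 7/4`: the difference is `|x|` times a square times a
positive factor. It converts second and fourth moments into a lower bound on the first absolute
moment. -/
lemma le_abs_of_quartic (x : ℝ) : 6 / 7 * x ^ 2 - 32 / 343 * x ^ 4 ≤ |x| := by
  have h0 := abs_nonneg x
  have e2 : x ^ 2 = |x| ^ 2 := (sq_abs x).symm
  have e4 : x ^ 4 = |x| ^ 4 := by rw [show x ^ 4 = (x ^ 2) ^ 2 by ring, e2]; ring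
  rw [e2, e4]
  have : 0 ≤ |x| * ((4 / 7 * |x| - 1) ^ 2 * (4 / 7 * |x| + 2)) := by positivity
  nlinarith [this]

/-- The normalized sum has second moment 1 and fourth moment `3 - 2/n`, and `6/7 - 3·32/343 =
198/343`; the `2/n` only helps. -/
lemma le_sum_abs_signSum (hn : 1 ≤ n) :
    198 / 343 * √n * 2 ^ n ≤ ∑ σ : Fin n → ℤˣ, |signSum σ| := by
  have hn0 : (0 : ℝ) < n := by exact_mod_cast hn
  have hs : 0 < √(n : ℝ) := Real.sqrt_pos.2 hn0
  have hss : √(n : ℝ) ^ 2 = n := Real.sq_sqrt hn0.le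
  have hp : ∀ σ : Fin n → ℤˣ,
      √n * (6 / 7 / n * signSum σ ^ 2 - 32 / 343 / n ^ 2 * signSum σ ^ 4) ≤ |signSum σ| := fun σ => by
    have h := le_abs_of_quartic (signSum σ / √n)
    rw [abs_div, abs_of_pos hs, le_div_iff₀ hs, div_pow, div_pow, hss,
      show √(n : ℝ) ^ 4 = (√(n : ℝ) ^ 2) ^ 2 by ring, hss] at h
    refine le_trans (le_of_eq ?_) h
    field_simp
  refine le_trans ?_ (Finset.sum_le_sum fun (σ : Fin n → ℤˣ) (_ : σ ∈ Finset.univ) => hp σ)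
  rw [← Finset.mul_sum, Finset.sum_sub_distrib, ← Finset.mul_sum, ← Finset.mul_sum, sum_signSum_sq,
    sum_signSum_pow_four]
  have : √(n : ℝ) * (6 / 7 / n * (n * 2 ^ n) - 32 / 343 / n ^ 2 * ((3 * n ^ 2 - 2 * n) * 2 ^ n))
      - 198 / 343 * √n * 2 ^ n = √n * 2 ^ n * (64 / 343 / n) := by
    field_simp
    ring
  have h2 : 0 ≤ √(n : ℝ) * 2 ^ n * (64 / 343 / n) := by positivity
  linarith

/-- The mean of `|∑ σ i * t i|` is smallest, for a given sum of the `t i`, when all are equal. -/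
lemma sum_abs_signSum_mul_le [NeZero n] (t : Fin n → ℝ) :
    (∑ σ : Fin n → ℤˣ, |signSum σ|) * |∑ j, t j|
      ≤ n * ∑ σ : Fin n → ℤˣ, |∑ j, ((σ j : ℤ) : ℝ) * t j| := by
  -- Cyclic shifts of `t` leave the sign average unchanged, while summing all shifts for fixed `σ`
  -- gives `signSum σ * ∑ t`; the triangle inequality finishes.
  have hk : ∀ k : Fin n, ∑ σ : Fin n → ℤˣ, |∑ j, ((σ j : ℤ) : ℝ) * t (j + k)|
      = ∑ σ : Fin n → ℤˣ, |∑ j, ((σ j : ℤ) : ℝ) * t j| := fun k => by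
    rw [← ((Equiv.addRight k).symm.arrowCongr (Equiv.refl ℤˣ)).sum_comp]
    refine Finset.sum_congr rfl fun σ _ => ?_
    rw [← Equiv.sum_comp (Equiv.addRight k) fun j => ((σ j : ℤ) : ℝ) * t j]
    simp
  have hs : ∀ σ : Fin n → ℤˣ, |signSum σ| * |∑ j, t j|
      ≤ ∑ k : Fin n, |∑ j, ((σ j : ℤ) : ℝ) * t (j + k)| := fun σ => by
    refine le_trans (le_of_eq ?_) (Finset.abs_sum_le_sum_abs _ _)
    rw [Finset.sum_comm, ← abs_mul, signSum, Finset.sum_mul]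
    congr 1
    refine Finset.sum_congr rfl fun j _ => ?_
    rw [← Finset.mul_sum, ← Equiv.sum_comp (Equiv.addLeft j) t]
    rfl
  rw [Finset.sum_mul]
  refine (Finset.sum_le_sum fun σ _ => hs σ).trans (le_of_eq ?_)
  rw [Finset.sum_comm]
  simp_rw [hk]
  simp

end SignSums

/-! ### The complexity of `F` compared with the Rademacher average of its ramps. -/

section EmpRademacher

variable {X : Type*} {n : ℕ} {F : Set (X → ℝ)}

lemma empRademacher_lower_bound (hn : 1 ≤ n) {f : X → ℝ} (hf : f ∈ F) (x : Fin n → X) :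
    ENNReal.ofReal (2 * (198 / 343) * |1 / (n : ℝ) * ∑ j, f (x j)| / √n) ≤ empRademacher F x := by
  have hn0 : (0 : ℝ) < n := by exact_mod_cast hn
  have : NeZero n := ⟨by omega⟩
  have hs : 0 < √(n : ℝ) := Real.sqrt_pos.2 hn0
  have hss : √(n : ℝ) ^ 2 = n := Real.sq_sqrt hn0.le
  have hle : (∑ σ : Fin n → ℤˣ, ENNReal.ofReal |(2 / (n : ℝ)) * ∑ i, ((σ i : ℤ) : ℝ) * f (x i)|)
      / 2 ^ n ≤ empRademacher F x :=
    ENNReal.div_le_div_right (Finset.sum_le_sum fun σ _ => le_iSup₂ (α := ℝ≥0∞)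
      (f := fun (f : X → ℝ) (_ : f ∈ F) =>
        ENNReal.ofReal |(2 / (n : ℝ)) * ∑ i, ((σ i : ℤ) : ℝ) * f (x i)|) f hf) _
  refine le_trans ?_ hle
  rw [← ENNReal.ofReal_sum_of_nonneg fun _ _ => abs_nonneg _,
    show (2 : ℝ≥0∞) ^ n = ENNReal.ofReal (2 ^ n) by
      rw [ENNReal.ofReal_pow zero_le_two]; simp,
    ← ENNReal.ofReal_div_of_pos (by positivity)]
  refine ENNReal.ofReal_le_ofReal ?_
  have h1 := sum_abs_signSum_mul_le fun j => f (x j)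
  have h2 := mul_le_mul_of_nonneg_right (le_sum_abs_signSum hn) (abs_nonneg (∑ j, f (x j)))
  simp_rw [abs_mul, abs_of_pos (by positivity : 0 < 2 / (n : ℝ)),
    abs_of_pos (by positivity : 0 < 1 / (n : ℝ)), ← Finset.mul_sum]
  rw [le_div_iff₀ (by positivity)]
  have h3 := h2.trans h1
  have e : 2 * (198 / 343) * (1 / (n : ℝ) * |∑ j, f (x j)|) / √n * 2 ^ n
      = 2 / n * ((198 / 343 * √n * 2 ^ n * |∑ j, f (x j)|) / n) := by
    field_simp
    rw [hss]
    ring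
  rw [e]
  refine mul_le_mul_of_nonneg_left ?_ (by positivity)
  rw [div_le_iff₀ hn0]
  linarith

lemma measurable_empRademacher [MeasurableSpace X] (hF : ∀ f ∈ F, Measurable f)
    (hsep : PointwiseSeparable F) : Measurable fun x : Fin n → X => empRademacher F x := by
  obtain ⟨F₀, hsub, hc, happ⟩ := hsep
  refine Measurable.div_const (Finset.measurable_sum _ fun σ _ => ?_) _
  have : (fun x : Fin n → X => ⨆ f ∈ F,
        ENNReal.ofReal |(2 / (n : ℝ)) * ∑ i, ((σ i : ℤ) : ℝ) * f (x i)|)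
      = fun x => ⨆ f ∈ F₀, ENNReal.ofReal |(2 / (n : ℝ)) * ∑ i, ((σ i : ℤ) : ℝ) * f (x i)| := by
    funext x
    refine le_antisymm (iSup₂_le fun f hf => ?_) (biSup_mono hsub)
    obtain ⟨g, hg, hlim⟩ := happ f hf
    refine le_of_tendsto' ((ENNReal.continuous_ofReal.tendsto _).comp
      ((tendsto_finsetSum _ fun i _ => (hlim (x i)).const_mul _).const_mul _).abs) fun k => ?_
    exact le_iSup₂ (α := ℝ≥0∞) (f := fun (f : X → ℝ) (_ : f ∈ F₀) =>
        ENNReal.ofReal |(2 / (n : ℝ)) * ∑ i, ((σ i : ℤ) : ℝ) * f (x i)|) (g k) (hg k)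
  rw [this]
  refine Measurable.biSup _ hc fun f hf => ENNReal.measurable_ofReal.comp ?_
  refine measurable_abs.comp (measurable_const.mul (Finset.measurable_sum _ fun i _ =>
    measurable_const.mul ((hF f (hsub hf)).comp (measurable_pi_apply i))))

/-- The ramp function of the margin at scale `1 / lam`. -/
noncomputable def ramp (lam : ℝ) (f : X → ℝ) (a : X) : ℝ := min 1 (max 0 (lam * (1 - f a)))

lemma ramp_nonneg (lam : ℝ) (f : X → ℝ) (a : X) : 0 ≤ ramp lam f a :=
  le_min zero_le_one (le_max_left _ _)

lemma ramp_le_one (lam : ℝ) (f : X → ℝ) (a : X) : ramp lam f a ≤ 1 := min_le_left _ _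

lemma measurable_ramp [MeasurableSpace X] (lam : ℝ) {f : X → ℝ} (hf : Measurable f) :
    Measurable (ramp lam f) :=
  measurable_const.min (measurable_const.max (measurable_const.mul (measurable_const.sub hf)))

lemma ramp_le_marginError {lam : ℝ} (hl : 0 ≤ lam) (f : X → ℝ) (a : X) :
    ramp lam f a ≤ lam * marginError f a := by
  refine (min_le_right _ _).trans (max_le ?_ ?_)
  · exact mul_nonneg hl (le_max_left _ _)
  · exact mul_le_mul_of_nonneg_left (le_max_right _ _) hl

lemma abs_clip_sub_clip_le (s t : ℝ) :
    |min 1 (max 0 s) - min 1 (max 0 t)| ≤ |s - t| := by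
  refine (abs_min_sub_min_le_max _ _ _ _).trans ?_
  rw [sub_self, abs_zero, max_eq_right (abs_nonneg _)]
  refine (abs_max_sub_max_le_max _ _ _ _).trans ?_
  rw [sub_self, abs_zero, max_eq_right (abs_nonneg _)]

/-- The Rademacher average of a class of ramp functions with scales in `[a, b]`. -/
lemma rademacherAverage_ramp_le {ι : Type*} [Nonempty ι] (hn : 1 ≤ n) {f : ι → X → ℝ}
    (hf : ∀ i, f i ∈ F) {lam : ι → ℝ} {a b : ℝ} (ha : 0 ≤ a) (hlam : ∀ i, lam i ∈ Set.Icc a b)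
    (x : Fin n → X) (hfin : empRademacher F x ≠ ∞) :
    √n * rademacherAverage (fun i => ramp (lam i) (f i)) x
      ≤ b * (√n * (empRademacher F x).toReal) + (b - a) := by
  have hn0 : (0 : ℝ) < n := by exact_mod_cast hn
  have hs : 0 < √(n : ℝ) := Real.sqrt_pos.2 hn0
  have hss : √(n : ℝ) * √n = n := Real.mul_self_sqrt hn0.le
  have hab : a ≤ b := (hlam (Classical.arbitrary ι)).1.trans (hlam _).2
  set W : (Fin n → ℤˣ) → ℝ≥0∞ := fun σ => ⨆ f ∈ F,
    ENNReal.ofReal |(2 / (n : ℝ)) * ∑ i, ((σ i : ℤ) : ℝ) * f (x i)| with hW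
  have h2n : (2 : ℝ≥0∞) ^ n ≠ ∞ := ENNReal.pow_ne_top (by simp)
  have hsum : ∑ σ, W σ ≠ ∞ := fun h => hfin (by
    change (∑ σ, W σ) / 2 ^ n = ∞
    rw [h, ENNReal.top_div_of_ne_top h2n])
  have hWfin : ∀ σ, W σ ≠ ∞ := fun σ => (ENNReal.sum_ne_top.1 hsum) σ (Finset.mem_univ σ)
  have hR : (empRademacher F x).toReal = (∑ σ, (W σ).toReal) / 2 ^ n := by
    rw [show empRademacher F x = (∑ σ, W σ) / 2 ^ n from rfl, ENNReal.toReal_div,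
      ENNReal.toReal_sum fun σ _ => hWfin σ]
    simp
  have hVle : ∀ σ, ∀ g ∈ F, |(2 / (n : ℝ)) * ∑ i, ((σ i : ℤ) : ℝ) * g (x i)| ≤ (W σ).toReal :=
    fun σ g hg => by
      rw [← ENNReal.ofReal_le_iff_le_toReal (hWfin σ)]
      exact le_iSup₂ (α := ℝ≥0∞) (f := fun (f : X → ℝ) (_ : f ∈ F) =>
        ENNReal.ofReal |(2 / (n : ℝ)) * ∑ i, ((σ i : ℤ) : ℝ) * f (x i)|) g hg
  set B : ℝ := ∑ σ, (W σ).toReal with hB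
  have hVB : ∀ σ, (W σ).toReal ≤ B := fun σ =>
    Finset.single_le_sum (f := fun σ => (W σ).toReal) (fun _ _ => ENNReal.toReal_nonneg)
      (Finset.mem_univ σ)
  -- Finite complexity bounds `F` on the sample, as real suprema in the contraction principle
  -- require: two sign vectors differing only at `k` isolate `g (x k)`.
  have hbound : ∀ g ∈ F, ∀ k, |g (x k)| ≤ n * B := fun g hg k => by
    have h1 := (hVle 1 g hg).trans (hVB 1)
    have h2 := (hVle (flipSign k 1) g hg).trans (hVB _)
    rw [sum_sign_mul_eq k] at h1
    rw [sum_flipSign_mul_eq k] at h2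
    rw [mul_add] at h1
    rw [mul_sub] at h2
    have h3 := abs_sub _ _ |>.trans (add_le_add h1 h2)
    have e : ∀ p q : ℝ, p + q - (p - q) = 2 * q := fun p q => by ring
    rw [e, Pi.one_apply, Units.val_one, Int.cast_one, one_mul, abs_mul, abs_mul, abs_two,
      abs_of_pos (by positivity : 0 < 2 / (n : ℝ))] at h3
    have h4 : 2 * (2 / n * |g (x k)|) = 4 * |g (x k)| / n := by ring
    rw [h4, div_le_iff₀ hn0] at h3
    have : 0 ≤ B * n := mul_nonneg (Finset.sum_nonneg fun _ _ => ENNReal.toReal_nonneg) hn0.le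
    linarith
  have hB0 : 0 ≤ B := Finset.sum_nonneg fun _ _ => ENNReal.toReal_nonneg
  have hb0 : 0 ≤ b := ha.trans hab
  have hlabs : ∀ i, |lam i| ≤ b := fun i => by
    rw [abs_of_nonneg (ha.trans (hlam i).1)]; exact (hlam i).2
  -- The scale sits inside the contracted quantity `lam i * (1 - f i (x j))`, so the same
  -- 1-Lipschitz clipping serves every index even though scales vary.
  have hcon := sum_iSup_contraction (n := n) (t := fun i j => lam i * (1 - f i (x j)))
    (s := fun i j => ramp (lam i) (f i) (x j)) (C := max 1 (b * (1 + n * B)))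
    (fun i j => by
      refine le_trans ?_ (le_max_right _ _)
      rw [abs_mul]
      refine mul_le_mul (hlabs i) ?_ (abs_nonneg _) hb0
      refine (abs_sub _ _).trans ?_
      rw [abs_one]
      linarith [hbound _ (hf i) j])
    (fun i j => by
      refine le_trans ?_ (le_max_left _ _)
      rw [abs_of_nonneg (ramp_nonneg _ _ _)]
      exact ramp_le_one _ _ _)
    (fun i i' j => abs_clip_sub_clip_le _ _) (by positivity : 0 ≤ 2 / (n : ℝ))
  have hσ : ∀ σ : Fin n → ℤˣ, (⨆ i, (2 / (n : ℝ)) * ∑ j, ((σ j : ℤ) : ℝ) * (lam i * (1 - f i (x j))))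
      ≤ (a + b) / n * signSum σ + (b - a) / n * |signSum σ| + b * (W σ).toReal := fun σ => by
    refine ciSup_le fun i => ?_
    have e : (2 / (n : ℝ)) * ∑ j, ((σ j : ℤ) : ℝ) * (lam i * (1 - f i (x j)))
        = 2 / n * (lam i * signSum σ) - lam i * ((2 / n) * ∑ j, ((σ j : ℤ) : ℝ) * f i (x j)) := by
      have : ∀ j, ((σ j : ℤ) : ℝ) * (lam i * (1 - f i (x j)))
          = lam i * ((σ j : ℤ) : ℝ) - lam i * (((σ j : ℤ) : ℝ) * f i (x j)) := fun j => by ring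
      simp_rw [this]
      rw [Finset.sum_sub_distrib, ← Finset.mul_sum, ← Finset.mul_sum, signSum]
      ring
    rw [e]
    -- Split `lam i` into the midpoint of `[a, b]` and a remainder of size at most `(b - a)/2`. The
    -- midpoint term averages to zero, so the constant 1 in `1 - f` costs `b - a` and not `b`.
    have h1 : lam i * signSum σ ≤ (a + b) / 2 * signSum σ + (b - a) / 2 * |signSum σ| := by
      rcases abs_cases (signSum σ) with ⟨h, h'⟩ | ⟨h, h'⟩
      · rw [h]; nlinarith [(hlam i).2]
      · rw [h]; nlinarith [(hlam i).1]
    have h2 : -(lam i * ((2 / n) * ∑ j, ((σ j : ℤ) : ℝ) * f i (x j))) ≤ b * (W σ).toReal := by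
      refine (neg_le_abs _).trans ?_
      rw [abs_mul]
      exact mul_le_mul (hlabs i) (hVle σ _ (hf i)) (abs_nonneg _) hb0
    have h3 := mul_le_mul_of_nonneg_left h1 (by positivity : 0 ≤ 2 / (n : ℝ))
    have e3 : 2 / (n : ℝ) * ((a + b) / 2 * signSum σ + (b - a) / 2 * |signSum σ|)
        = (a + b) / n * signSum σ + (b - a) / n * |signSum σ| := by ring
    linarith
  have hfinal := hcon.trans (Finset.sum_le_sum fun σ _ => hσ σ)
  rw [Finset.sum_add_distrib, Finset.sum_add_distrib, ← Finset.mul_sum, ← Finset.mul_sum,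
    ← Finset.mul_sum, sum_signSum, mul_zero, zero_add, ← hB] at hfinal
  have h5 := mul_le_mul_of_nonneg_left (sum_abs_signSum_le hn)
    (div_nonneg (sub_nonneg.2 hab) hn0.le)
  have h6 : (∑ σ : Fin n → ℤˣ, signedSup (fun i => ramp (lam i) (f i)) σ x)
      ≤ (b - a) / n * (√n * 2 ^ n) + b * B := by
    refine le_trans ?_ (hfinal.trans (add_le_add_left h5 _))
    exact le_rfl
  rw [rademacherAverage, hR]
  have h7 := mul_le_mul_of_nonneg_left h6 (by positivity : 0 ≤ √(n : ℝ) / 2 ^ n)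
  have e1 : √(n : ℝ) / 2 ^ n * ((b - a) / n * (√n * 2 ^ n) + b * B)
      = b * (√n * (B / 2 ^ n)) + (b - a) := by
    have : √(n : ℝ) / 2 ^ n * ((b - a) / n * (√n * 2 ^ n) + b * B)
      = (b - a) * (√n * √n) / n + b * (√n * (B / 2 ^ n)) := by field_simp
    rw [this, hss]
    field_simp
    ring
  rw [e1] at h7
  refine le_trans (le_of_eq ?_) h7
  ring

end EmpRademacher

/-- Every extended nonnegative random variable has quantiles. -/
lemma exists_quantile {Ω : Type*} [MeasurableSpace Ω] (μ : Measure Ω) [IsProbabilityMeasure μ]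
    {ρ : Ω → ℝ≥0∞} (hρ : Measurable ρ) {α : ℝ} (hα : 0 ≤ α) (hα1 : α ≤ 1) :
    ∃ M : ℝ≥0∞, μ.real {x | ρ x < M} ≤ α ∧ α ≤ μ.real {x | ρ x ≤ M} := by
  set S : Set ℝ≥0∞ := {m | α ≤ μ.real {x | ρ x ≤ m}} with hS
  have htop : ∞ ∈ S := by simpa [hS] using hα1
  refine ⟨sInf S, ?_, ?_⟩
  · rcases eq_or_ne (sInf S) 0 with h0 | h0
    · simpa [h0] using hα
    obtain ⟨u, hu, hlt, hlim⟩ := exists_seq_strictMono_tendsto' (pos_iff_ne_zero.2 h0)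
    have hun : {x | ρ x < sInf S} = ⋃ k, {x | ρ x ≤ u k} := by
      ext x
      simp only [Set.mem_ofPred_eq, Set.mem_iUnion]
      refine ⟨fun h => ?_, fun ⟨k, hk⟩ => hk.trans_lt (hlt k).2⟩
      obtain ⟨k, hk⟩ := (hlim.eventually (lt_mem_nhds h)).exists
      exact ⟨k, hk.le⟩
    have hmono : Monotone fun k => {x | ρ x ≤ u k} := fun i j hij x hx =>
      le_trans hx (hu.monotone hij)
    have ht := tendsto_measure_iUnion_atTop (μ := μ) hmono
    rw [← hun] at ht
    refine le_of_tendsto' ((ENNReal.tendsto_toReal (measure_ne_top μ _)).comp ht) fun k => ?_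
    by_contra hcon
    exact absurd (sInf_le (show u k ∈ S from (not_le.1 hcon).le)) (not_le.2 (hlt k).2)
  · obtain ⟨u, hu, hlim, hmem⟩ := exists_seq_tendsto_sInf ⟨∞, htop⟩ (OrderBot.bddBelow S)
    have hin : {x | ρ x ≤ sInf S} = ⋂ k, {x | ρ x ≤ u k} := by
      ext x
      simp only [Set.mem_ofPred_eq, Set.mem_iInter]
      exact ⟨fun h k => h.trans (sInf_le (hmem k)), fun h => ge_of_tendsto' hlim h⟩
    have hanti : Antitone fun k => {x | ρ x ≤ u k} := fun i j hij x hx => le_trans hx (hu hij)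
    have ht := tendsto_measure_iInter_atTop (μ := μ)
      (fun k => (measurableSet_le hρ measurable_const).nullMeasurableSet) hanti
      ⟨0, measure_ne_top μ _⟩
    rw [← hin] at ht
    exact ge_of_tendsto' ((ENNReal.tendsto_toReal (measure_ne_top μ _)).comp ht) fun k => hmem k

/-! ### Uniform deviation over one interval of scales. -/

section Shell

variable {X : Type*} [MeasurableSpace X] {P : Measure X} [IsProbabilityMeasure P]
  {F : Set (X → ℝ)} {n : ℕ}

lemma tendsto_ramp {g : ℕ → X → ℝ} {f : X → ℝ} {l : ℕ → ℝ} {lam : ℝ} {a : X}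
    (hl : Tendsto l atTop (𝓝 lam)) (hg : Tendsto (fun k => g k a) atTop (𝓝 (f a))) :
    Tendsto (fun k => ramp (l k) (g k) a) atTop (𝓝 (ramp lam f a)) :=
  tendsto_const_nhds.min (tendsto_const_nhds.max (hl.mul (tendsto_const_nhds.sub hg)))

lemma tendsto_ramp_deviation {g : ℕ → X → ℝ} {f : X → ℝ} {l : ℕ → ℝ} {lam : ℝ}
    (hgm : ∀ k, Measurable (g k)) (hl : Tendsto l atTop (𝓝 lam))
    (hg : ∀ a, Tendsto (fun k => g k a) atTop (𝓝 (f a))) (x : Fin n → X) :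
    Tendsto (fun k => ∫ a, ramp (l k) (g k) a ∂P - 1 / (n : ℝ) * ∑ j, ramp (l k) (g k) (x j)) atTop
      (𝓝 (∫ a, ramp lam f a ∂P - 1 / (n : ℝ) * ∑ j, ramp lam f (x j))) := by
  refine Tendsto.sub ?_ ((tendsto_finsetSum _ fun j _ => tendsto_ramp hl (hg _)).const_mul _)
  refine tendsto_integral_of_dominated_convergence (fun _ => 1)
    (fun k => (measurable_ramp _ (hgm k)).aestronglyMeasurable) (integrable_const _)
    (fun k => ae_of_all _ fun a => ?_) (ae_of_all _ fun a => tendsto_ramp hl (hg a))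
  rw [Real.norm_eq_abs, abs_of_nonneg (ramp_nonneg _ _ _)]
  exact ramp_le_one _ _ _

/-- Uniform deviation bound for the ramp functions with scales in `[a, b]`. -/
theorem exists_uniform_ramp_bound (hn : 1 ≤ n) (hF : ∀ f ∈ F, Measurable f)
    (hsep : PointwiseSeparable F) (hne : F.Nonempty) {a b : ℝ} (ha : 0 ≤ a) (hab : a ≤ b) :
    ∃ Q : ℝ, (∀ M d : ℝ, 0 ≤ M → 0 < d →
        min (Real.exp (-2 * d ^ 2)) (1 / (1 + 4 * d ^ 2)) < (Measure.pi fun _ : Fin n => P).real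
          {x | ENNReal.ofReal √n * empRademacher F x ≤ ENNReal.ofReal M} →
        Q ≤ b * M + (b - a) + d) ∧
      ∀ s, 0 ≤ s → ∃ E : Set (Fin n → X), MeasurableSet E ∧
        (Measure.pi fun _ : Fin n => P).real Eᶜ ≤ Real.exp (-2 * s ^ 2) ∧
        ∀ x ∈ E, ∀ f ∈ F, ∀ lam ∈ Set.Icc a b,
          √n * (∫ a, ramp lam f a ∂P - 1 / (n : ℝ) * ∑ j, ramp lam f (x j)) ≤ Q + s := by
  obtain ⟨F₀, hsub, hc, happ⟩ := hsep
  have hn0 : (0 : ℝ) < n := by exact_mod_cast hn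
  have hs0 : 0 < √(n : ℝ) := Real.sqrt_pos.2 hn0
  obtain ⟨f₀, hf₀⟩ : F₀.Nonempty := by
    obtain ⟨f, hf⟩ := hne
    obtain ⟨g, hg, -⟩ := happ f hf
    exact ⟨g 0, hg 0⟩
  have : Countable F₀ := hc.to_subtype
  have : Nonempty F₀ := ⟨⟨f₀, hf₀⟩⟩
  have : Nonempty (Set.Icc a b) := ⟨⟨a, le_rfl, hab⟩⟩
  set D : ℕ → Set.Icc a b := TopologicalSpace.denseSeq (Set.Icc a b)
  set h : F₀ × ℕ → X → ℝ := fun i => ramp (D i.2 : ℝ) (i.1 : X → ℝ) with hh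
  have hm : ∀ i, Measurable (h i) := fun i => measurable_ramp _ (hF _ (hsub i.1.2))
  have h0 : ∀ i c, 0 ≤ h i c := fun i c => ramp_nonneg _ _ _
  have h1 : ∀ i c, h i c ≤ 1 := fun i c => ramp_le_one _ _ _
  set μ := Measure.pi fun _ : Fin n => P
  refine ⟨√n * ∫ x, rademacherAverage h x ∂μ, fun M d hM hd hlt => ?_, fun s hs => ?_⟩
  -- If `Q` were larger, every sample with `ρ ≤ M` would lie in the lower tail of the Rademacher
  -- average, contradicting the assumed probability.
  · by_contra! hcon
    refine absurd hlt (not_lt.2 (le_trans (measureReal_mono fun x hx => ?_)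
      (measureReal_lower_tail_le_of_bounded_differences hn (measurable_rademacherAverage hm)
      (K := 2) (fun x => abs_rademacherAverage_le hn h0 h1 x)
      (fun x i c => rademacherAverage_bounded_differences hn h0 h1 x i c) hd)))
    have hx' : ENNReal.ofReal √n * empRademacher F x ≤ ENNReal.ofReal M := hx
    have hfin : empRademacher F x ≠ ∞ := fun htop => by
      rw [htop, ENNReal.mul_top (by simpa using hn0)] at hx'
      exact absurd hx' (by simp)
    have hr : √n * (empRademacher F x).toReal ≤ M := by
      have := ENNReal.toReal_mono ENNReal.ofReal_ne_top hx'
      rwa [ENNReal.toReal_mul, ENNReal.toReal_ofReal hs0.le, ENNReal.toReal_ofReal hM] at this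
    have hle := rademacherAverage_ramp_le (F := F) hn (f := fun i : F₀ × ℕ => (i.1 : X → ℝ))
      (fun i => hsub i.1.2) (lam := fun i => (D i.2 : ℝ)) ha (fun i => (D i.2).2) x hfin
    have := mul_le_mul_of_nonneg_left hr (ha.trans hab)
    change √n * rademacherAverage h x + d ≤ _
    change √n * rademacherAverage h x ≤ _ at hle
    linarith
  · refine ⟨{x | √n * maxDeviation P h x < √n * (∫ x, rademacherAverage h x ∂μ) + s},
      measurableSet_lt (measurable_const.mul (measurable_maxDeviation hm)) measurable_const, ?_, ?_⟩
    · refine le_trans (measureReal_mono fun x hx => ?_)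
        (measureReal_upper_tail_le_of_bounded_differences hn (measurable_maxDeviation (P := P) hm)
        (K := 1) (fun x => abs_maxDeviation_le hn hm h0 h1 x)
        (fun x i c => maxDeviation_bounded_differences hn hm h0 h1 x i c) hs)
      have hx' : √n * (∫ x, rademacherAverage h x ∂μ) + s ≤ √n * maxDeviation P h x := not_lt.1 hx
      have := mul_le_mul_of_nonneg_left (integral_maxDeviation_le (P := P) hn hm h0 h1) hs0.le
      change √n * (∫ x, maxDeviation P h x ∂μ) + s ≤ √n * maxDeviation P h x
      linarith
    · intro x hx f hf lam hlam
      obtain ⟨g, hg, hlim⟩ := happ f hf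
      -- From the countable index set, pointwise limits in `f` and density in `lam` reach every
      -- pair; the deviation passes to the limit by dominated convergence.
      obtain ⟨l, hl, hllim⟩ := mem_closure_iff_seq_limit.1
        ((TopologicalSpace.denseRange_denseSeq (Set.Icc a b)).closure_range ▸
          Set.mem_univ (⟨lam, hlam⟩ : Set.Icc a b))
      choose k hk using hl
      have hllim' : Tendsto (fun m => (D (k m) : ℝ)) atTop (𝓝 lam) := by
        have := (continuous_subtype_val.tendsto _).comp hllim
        refine this.congr fun m => ?_
        simp [D, hk]
      refine le_of_tendsto' ((tendsto_ramp_deviation (P := P) (fun m => hF _ (hsub (hg m))) hllim' hlim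
        x).const_mul √(n : ℝ)) fun m => ?_
      have := le_ciSup (bddAbove_deviation (P := P) hn hm h0 h1 x) (⟨g m, hg m⟩, k m)
      have h2 := mul_le_mul_of_nonneg_left this hs0.le
      exact h2.trans (le_of_lt hx)

end Shell

/-! ### Numerical budgets for the confidence term and the margins. -/

section Numerics

lemma exp_neg_le_of_taylor {x c : ℝ} (m : ℕ) (hx : 0 ≤ x)
    (h : 1 ≤ c * ∑ i ∈ Finset.range m, x ^ i / i.factorial) : Real.exp (-x) ≤ c := by
  have h1 := Real.sum_le_exp_of_nonneg hx m
  have h0 : 0 ≤ ∑ i ∈ Finset.range m, x ^ i / i.factorial :=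
    Finset.sum_nonneg fun i _ => by positivity
  have hc : 0 ≤ c := by
    by_contra hc
    nlinarith [mul_nonneg (le_of_lt (neg_pos.2 (not_le.1 hc))) h0]
  rw [Real.exp_neg, inv_le_iff_one_le_mul₀ (Real.exp_pos x)]
  exact h.trans (mul_le_mul_of_nonneg_left h1 hc)

/-- Partial sums of a sequence with a geometric tail. -/
lemma sum_range_le_of_geometric_tail {e : ℕ → ℝ} {A q : ℝ} (m : ℕ) (he : ∀ k, 0 ≤ e k)
    (hA : 0 ≤ A) (hq : 0 ≤ q) (hq1 : q < 1) (h : ∀ k, e (m + k) ≤ A * q ^ k) (N : ℕ) :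
    ∑ k ∈ Finset.range N, e k ≤ (∑ k ∈ Finset.range m, e k) + A / (1 - q) := by
  have h1 : ∑ k ∈ Finset.range N, e k ≤ ∑ k ∈ Finset.range (m + N), e k :=
    Finset.sum_le_sum_of_subset_of_nonneg (Finset.range_mono (by omega)) fun k _ _ => he k
  refine h1.trans ?_
  rw [Finset.sum_range_add]
  refine add_le_add_right ((Finset.sum_le_sum fun k _ => h k).trans ?_) _
  rw [← Finset.mul_sum, div_eq_mul_inv]
  refine mul_le_mul_of_nonneg_left ?_ hA
  rw [← tsum_geometric_of_lt_one hq hq1]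
  exact (summable_geometric_of_lt_one hq hq1).sum_le_tsum _ fun k _ => pow_nonneg hq k

/-- The normalized confidence term `3 √(ln (2 / η) / 2)`. -/
noncomputable def confidenceTerm (η : ℝ) : ℝ := 3 * √(Real.log (2 / η) / 2)

variable {η : ℝ}

lemma log_two_div_eq (hη0 : 0 < η) (hη1 : η ≤ 1) :
    Real.log (2 / η) = 2 / 9 * confidenceTerm η ^ 2 := by
  have : 0 ≤ Real.log (2 / η) := Real.log_nonneg (by rw [le_div_iff₀ hη0]; linarith)
  rw [confidenceTerm, mul_pow, Real.sq_sqrt (by positivity)]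
  ring

lemma eq_two_mul_exp (hη0 : 0 < η) (hη1 : η ≤ 1) :
    η = 2 * Real.exp (-(2 / 9 * confidenceTerm η ^ 2)) := by
  rw [← log_two_div_eq hη0 hη1, Real.exp_neg, Real.exp_log (by positivity)]
  field_simp

lemma le_confidenceTerm (hη0 : 0 < η) (hη1 : η ≤ 1) : 1.766 ≤ confidenceTerm η := by
  have h1 : Real.log 2 ≤ Real.log (2 / η) :=
    Real.log_le_log (by norm_num) (by rw [le_div_iff₀ hη0]; linarith)
  rw [log_two_div_eq hη0 hη1] at h1
  have h0 : 0 ≤ confidenceTerm η := by unfold confidenceTerm; positivity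
  have := Real.log_two_gt_d9
  by_contra! hlt
  nlinarith

/-- Expand `η = 2 exp(-(2/9)T²)` at `T = 1.766 + τ`; the constant `(2/9)·1.766²` is just below `ln
2`, so the factor 2 absorbs it. -/
lemma exp_neg_le_of_quadratic (hη0 : 0 < η) (hη1 : η ≤ 1) {τ : ℝ} (hτ : confidenceTerm η = 1.766 + τ) :
    Real.exp (-(0.785 * τ + 0.2223 * τ ^ 2)) ≤ η := by
  have hT := le_confidenceTerm hη0 hη1
  have hτ0 : 0 ≤ τ := by linarith
  refine le_of_le_of_eq ?_ (eq_two_mul_exp hη0 hη1).symm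
  rw [hτ]
  nth_rewrite 1 [← Real.exp_log (by norm_num : (0 : ℝ) < 2)]
  rw [← Real.exp_add, Real.exp_le_exp]
  nlinarith [Real.log_two_gt_d9, sq_nonneg τ]

/-- A share `0.35` of the excess `τ` yields the factor `η` in every margin: `1.4 · 0.562 ≥ 0.785`
and `2 · 0.35² ≥ 0.2223`. The other `0.65` goes into the depth `d`. -/
lemma exp_neg_sq_le (hη0 : 0 < η) (hη1 : η ≤ 1) {τ v : ℝ} (hτ : confidenceTerm η = 1.766 + τ)
    (hv : 0.562 ≤ v) : Real.exp (-2 * (v + 0.35 * τ) ^ 2) ≤ η * Real.exp (-2 * v ^ 2) := by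
  have hT := le_confidenceTerm hη0 hη1
  have hτ0 : 0 ≤ τ := by linarith
  refine le_trans ?_ (mul_le_mul_of_nonneg_right (exp_neg_le_of_quadratic hη0 hη1 hτ)
    (Real.exp_pos _).le)
  rw [← Real.exp_add, Real.exp_le_exp]
  nlinarith [mul_nonneg hτ0 (sub_nonneg.2 hv), sq_nonneg τ]

lemma min_tail_lt (hη0 : 0 < η) (hη1 : η ≤ 1) {τ : ℝ} (hτ : confidenceTerm η = 1.766 + τ) :
    min (Real.exp (-2 * (0.266 + 0.65 * τ) ^ 2)) (1 / (1 + 4 * (0.266 + 0.65 * τ) ^ 2)) < 0.8 * η := by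
  have hT := le_confidenceTerm hη0 hη1
  have hτ0 : 0 ≤ τ := by linarith
  have hη := exp_neg_le_of_quadratic hη0 hη1 hτ
  -- At `τ = 0` the exponential bound is about `0.87`, too large; Cantelli gives about `0.78`. From
  -- `τ = 0.45` on the exponential bound suffices.
  rcases le_total τ 0.45 with h | h
  · refine (min_le_right _ _).trans_lt ?_
    rw [div_lt_iff₀ (by positivity)]
    have h1 := (Real.add_one_le_exp (-(0.785 * τ + 0.2223 * τ ^ 2))).trans hη
    have h2 : 0 < 1 + 4 * (0.266 + 0.65 * τ) ^ 2 := by positivity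
    have h3 := mul_le_mul_of_nonneg_right h1 h2.le
    have h4 : τ ^ 3 ≤ 0.2025 * τ := by nlinarith [mul_nonneg hτ0 (sub_nonneg.2 h)]
    have h5 : τ ^ 4 ≤ 0.0912 * τ := by nlinarith [mul_nonneg hτ0 (sub_nonneg.2 h), sq_nonneg τ]
    nlinarith [sq_nonneg τ]
  · refine (min_le_left _ _).trans_lt ?_
    have h1 : Real.exp (-0.2232) ≤ 0.8 :=
      exp_neg_le_of_taylor 5 (by norm_num) (by norm_num [Finset.sum_range_succ, Nat.factorial])
    refine lt_of_lt_of_le ?_ (mul_le_mul h1 hη (Real.exp_pos _).le (by norm_num))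
    rw [← Real.exp_add, Real.exp_lt_exp]
    nlinarith [mul_nonneg (sub_nonneg.2 h) hτ0]

/-- The margins of the arithmetic scales. -/
noncomputable def arithmeticMargin (k : ℕ) : ℝ := 1.22 - 0.08 * k + 0.46 * max 0 ((k : ℝ) - 5)

lemma le_arithmeticMargin (k : ℕ) : 0.82 ≤ arithmeticMargin k := by
  unfold arithmeticMargin
  rcases le_total (k : ℝ) 5 with h | h
  · rw [max_eq_left (by linarith)]; linarith
  · rw [max_eq_right (by linarith)]; linarith

lemma sum_exp_arithmeticMargin_le (N : ℕ) :
    ∑ k ∈ Finset.range N, Real.exp (-2 * arithmeticMargin k ^ 2) ≤ 1 := by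
  have hexp : ∀ v c : ℝ, 1 ≤ c * ∑ i ∈ Finset.range 12, (2 * v ^ 2) ^ i / i.factorial →
      Real.exp (-2 * v ^ 2) ≤ c := fun v c h => by
    rw [neg_mul]; exact exp_neg_le_of_taylor 12 (by positivity) h
  have h0 : Real.exp (-2 * arithmeticMargin 0 ^ 2) ≤ 0.052 := hexp _ _ (by
    norm_num [Finset.sum_range_succ, Nat.factorial, arithmeticMargin])
  have h1 : Real.exp (-2 * arithmeticMargin 1 ^ 2) ≤ 0.076 := hexp _ _ (by
    norm_num [Finset.sum_range_succ, Nat.factorial, arithmeticMargin])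
  have h2 : Real.exp (-2 * arithmeticMargin 2 ^ 2) ≤ 0.107 := hexp _ _ (by
    norm_num [Finset.sum_range_succ, Nat.factorial, arithmeticMargin])
  have h3 : Real.exp (-2 * arithmeticMargin 3 ^ 2) ≤ 0.148 := hexp _ _ (by
    norm_num [Finset.sum_range_succ, Nat.factorial, arithmeticMargin])
  have h4 : Real.exp (-2 * arithmeticMargin 4 ^ 2) ≤ 0.2 := hexp _ _ (by
    norm_num [Finset.sum_range_succ, Nat.factorial, arithmeticMargin])
  have h5 : Real.exp (-2 * arithmeticMargin 5 ^ 2) ≤ 0.263 := hexp _ _ (by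
    norm_num [Finset.sum_range_succ, Nat.factorial, arithmeticMargin])
  have h6 : Real.exp (-2.88) ≤ 0.058 :=
    exp_neg_le_of_taylor 12 (by norm_num) (by norm_num [Finset.sum_range_succ, Nat.factorial])
  have hq : Real.exp (-1.824) ≤ 0.2 :=
    exp_neg_le_of_taylor 10 (by norm_num) (by norm_num [Finset.sum_range_succ, Nat.factorial])
  -- From index 6 on the margin is `1.2 + 0.38 k`, and `2(1.2 + 0.38 k)² ≥ 2.88 + 1.824 k`.
  refine (sum_range_le_of_geometric_tail (A := 0.058) (q := 0.2) 6 (fun k => (Real.exp_pos _).le)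
    (by norm_num) (by norm_num) (by norm_num) (fun k => ?_) N).trans ?_
  · refine le_trans ?_ (mul_le_mul h6 (pow_le_pow_left₀ (Real.exp_pos _).le hq k) (by positivity)
      (by norm_num))
    rw [← Real.exp_nat_mul, ← Real.exp_add, Real.exp_le_exp, arithmeticMargin]
    have hk : (0 : ℝ) ≤ k := k.cast_nonneg
    push_cast
    rw [max_eq_right (by linarith)]
    nlinarith
  · simp only [Finset.sum_range_succ, Finset.sum_range_zero]
    linarith

/-- The margins of the geometric scales. -/
noncomputable def geometricMargin : ℕ → ℝ
  | 0 => 1.29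
  | k + 1 => 1.5 + 0.3 * (0.06 * 1.2 ^ k)

lemma le_geometricMargin (k : ℕ) : 1.29 ≤ geometricMargin k := by
  cases k with
  | zero => exact le_rfl
  | succ k =>
    have : (0 : ℝ) ≤ 0.3 * (0.06 * 1.2 ^ k) := by positivity
    simp only [geometricMargin]
    linarith

lemma sum_exp_geometricMargin_le (N : ℕ) :
    ∑ k ∈ Finset.range N, Real.exp (-2 * geometricMargin k ^ 2) ≤ 0.2 := by
  have h0 : Real.exp (-3.3282) ≤ 0.037 :=
    exp_neg_le_of_taylor 14 (by norm_num) (by norm_num [Finset.sum_range_succ, Nat.factorial])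
  have h1 : Real.exp (-4.5) ≤ 0.01112 :=
    exp_neg_le_of_taylor 18 (by norm_num) (by norm_num [Finset.sum_range_succ, Nat.factorial])
  have hA : Real.exp (-5.46) ≤ 0.0043 :=
    exp_neg_le_of_taylor 20 (by norm_num) (by norm_num [Finset.sum_range_succ, Nat.factorial])
  have hq : Real.exp (-0.1925) ≤ 0.825 :=
    exp_neg_le_of_taylor 6 (by norm_num) (by norm_num [Finset.sum_range_succ, Nat.factorial])
  have hsmall : ∀ k : ℕ, Real.exp (-2 * geometricMargin (k + 1) ^ 2) ≤ 0.01112 := fun k => by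
    refine le_trans (Real.exp_le_exp.2 ?_) h1
    have : (0 : ℝ) ≤ 0.3 * (0.06 * 1.2 ^ k) := by positivity
    simp only [geometricMargin]
    nlinarith
  -- Twelve margins of at least `1.5` are bounded crudely; from index 13 on, Bernoulli makes `1.2 ^
  -- (12 + k)` at least linear, hence a geometric tail.
  refine (sum_range_le_of_geometric_tail (A := 0.0043) (q := 0.825) 13 (fun k => (Real.exp_pos _).le)
    (by norm_num) (by norm_num) (by norm_num) (fun k => ?_) N).trans ?_
  · refine le_trans ?_ (mul_le_mul hA (pow_le_pow_left₀ (Real.exp_pos _).le hq k) (by positivity)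
      (by norm_num))
    rw [← Real.exp_nat_mul, ← Real.exp_add, Real.exp_le_exp, show 13 + k = (12 + k) + 1 by ring]
    simp only [geometricMargin]
    have hb := one_add_mul_le_pow (by norm_num : (-2 : ℝ) ≤ 0.2) k
    have hb' : (1.2 : ℝ) ^ (12 + k) ≥ 8.916 * (1 + k * 0.2) := by
      rw [pow_add]
      have e : (1 + 0.2 : ℝ) = 1.2 := by norm_num
      rw [e] at hb
      have : (8.916 : ℝ) ≤ 1.2 ^ 12 := by norm_num
      have hk : (0 : ℝ) ≤ k := k.cast_nonneg
      exact mul_le_mul this hb (by positivity) (by positivity)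
    nlinarith [sq_nonneg ((1.2 : ℝ) ^ (12 + k))]
  · rw [Finset.sum_range_succ']
    have hs : ∑ k ∈ Finset.range 12, Real.exp (-2 * geometricMargin (k + 1) ^ 2) ≤ 12 * 0.01112 :=
      (Finset.sum_le_sum fun k _ => hsmall k).trans (by simp)
    have hz : Real.exp (-2 * geometricMargin 0 ^ 2) ≤ 0.037 := by
      refine le_trans (le_of_eq ?_) h0
      norm_num [geometricMargin]
    linarith

end Numerics

/-! ### Union bound over intervals and the two regimes. -/

section Assembly

variable {X : Type*} [MeasurableSpace X] {P : Measure X} [IsProbabilityMeasure P]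
  {F : Set (X → ℝ)} {n : ℕ}

/-- Union bound over countably many ranges of scales. -/
lemma exists_peeled_bound (hn : 1 ≤ n) (hF : ∀ f ∈ F, Measurable f)
    (hsep : PointwiseSeparable F) (hne : F.Nonempty) {a b s : ℕ → ℝ} (ha : ∀ k, 0 ≤ a k)
    (hab : ∀ k, a k ≤ b k) (hs : ∀ k, 0 ≤ s k) {C : ℝ}
    (hC : ∀ N, ∑ k ∈ Finset.range N, Real.exp (-2 * s k ^ 2) ≤ C) {M d : ℝ} (hM : 0 ≤ M) (hd : 0 < d)
    (htail : min (Real.exp (-2 * d ^ 2)) (1 / (1 + 4 * d ^ 2)) <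
      (Measure.pi fun _ : Fin n => P).real
        {x | ENNReal.ofReal √n * empRademacher F x ≤ ENNReal.ofReal M}) :
    ∃ E : Set (Fin n → X), MeasurableSet E ∧ (Measure.pi fun _ : Fin n => P).real Eᶜ ≤ C ∧
      ∀ x ∈ E, ∀ k, ∀ f ∈ F, ∀ lam ∈ Set.Icc (a k) (b k),
        √n * (∫ a, ramp lam f a ∂P - 1 / (n : ℝ) * ∑ j, ramp lam f (x j))
          ≤ b k * M + (b k - a k) + d + s k := by
  have hshell := fun k => exists_uniform_ramp_bound (P := P) hn hF hsep hne (ha k) (hab k)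
  choose Q hQ hE using hshell
  choose E hEm hEP hE using fun k => hE k (s k) (hs k)
  have hC0 : 0 ≤ C := by simpa using hC 0
  refine ⟨⋂ k, E k, MeasurableSet.iInter hEm, ?_, fun x hx k f hf lam hlam => ?_⟩
  · rw [Set.compl_iInter, Measure.real]
    refine ENNReal.toReal_le_of_le_ofReal hC0 ((measure_iUnion_le _).trans ?_)
    refine ENNReal.tsum_le_of_sum_range_le fun N => ?_
    refine le_trans ?_ (ENNReal.ofReal_le_ofReal (hC N))
    rw [ENNReal.ofReal_sum_of_nonneg fun _ _ => (Real.exp_pos _).le]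
    refine Finset.sum_le_sum fun k _ => ?_
    exact (ENNReal.le_ofReal_iff_toReal_le (measure_ne_top _ _) (Real.exp_pos _).le).2 (hEP k)
  · exact (hE k x (Set.mem_iInter.1 hx k) f hf lam hlam).trans
      (by linarith [hQ k M d hM hd htail])

lemma measureReal_compl_decisionRegion_le {f : X → ℝ} (hf : Measurable f) {lam : ℝ} (hl : 0 < lam) :
    P.real (decisionRegion f (1 - 1 / lam))ᶜ ≤ ∫ a, ramp lam f a ∂P := by
  have hi : Integrable (ramp lam f) P :=
    Integrable.of_bound (measurable_ramp lam hf).aestronglyMeasurable 1 (ae_of_all _ fun a => by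
      rw [Real.norm_eq_abs, abs_of_nonneg (ramp_nonneg _ _ _)]
      exact ramp_le_one _ _ _)
  have hmk := mul_meas_ge_le_integral_of_nonneg (ae_of_all _ fun a => ramp_nonneg lam f a) hi 1
  rw [one_mul] at hmk
  refine le_trans (measureReal_mono fun a ha => ?_) hmk
  have ha' : f a < 1 - 1 / lam := not_le.1 ha
  have : 1 ≤ lam * (1 - f a) := by
    have h1 : 1 / lam ≤ 1 - f a := by linarith
    rw [div_le_iff₀ hl] at h1
    linarith
  exact le_min le_rfl (this.trans (le_max_right _ _))

/-- The bound for one function and one scale, from a deviation bound that may use the lower bound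
on the Rademacher complexity which holds whenever the margin term is not trivially large. -/
lemma measure_compl_decisionRegion_le (hn : 1 ≤ n) {f : X → ℝ} (hfF : f ∈ F) (hf : Measurable f)
    {lam T : ℝ} (hl : 0 < lam) (hT : 0 ≤ T) (x : Fin n → X)
    (H : empRademacher F x ≠ ∞ → 2.3 * (lam - 1) ≤ 2 * lam * (√n * (empRademacher F x).toReal) →
      √n * (∫ a, ramp lam f a ∂P - 1 / (n : ℝ) * ∑ j, ramp lam f (x j))
        ≤ T + 2 * lam * (√n * (empRademacher F x).toReal)) :
    P (decisionRegion f (1 - 1 / lam))ᶜ ≤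
      ENNReal.ofReal (lam * (1 / (n : ℝ) * ∑ i, marginError f (x i)))
        + ENNReal.ofReal (2 * lam) * empRademacher F x + ENNReal.ofReal (T / √n) := by
  have hn0 : (0 : ℝ) < n := by exact_mod_cast hn
  have hs : 0 < √(n : ℝ) := Real.sqrt_pos.2 hn0
  set A := 1 / (n : ℝ) * ∑ i, marginError f (x i) with hA
  have hA0 : 0 ≤ A := mul_nonneg (by positivity) (Finset.sum_nonneg fun i _ => le_max_left _ _)
  rcases le_or_gt 1 (lam * A) with h1 | h1
  · calc P (decisionRegion f (1 - 1 / lam))ᶜ ≤ 1 := prob_le_one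
      _ ≤ ENNReal.ofReal (lam * A) := by rw [← ENNReal.ofReal_one]; exact ENNReal.ofReal_le_ofReal h1
      _ ≤ _ := by rw [add_assoc]; exact le_self_add
  rcases eq_or_ne (empRademacher F x) ∞ with htop | hfin
  · rw [htop, ENNReal.mul_top (by simpa using hl)]
    simp
  -- Here `lam * A < 1`, and the sample mean of `f` is at least `1 - A`. The Khinchine bound gives
  -- the factor `4·198/343 > 2.3` in front of `lam(1 - A) ≥ lam - 1`.
  have hlow : 2.3 * (lam - 1) ≤ 2 * lam * (√n * (empRademacher F x).toReal) := by
    have h2 := empRademacher_lower_bound hn hfF x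
    rw [ENNReal.ofReal_le_iff_le_toReal hfin, div_le_iff₀ hs] at h2
    have h3 : 1 - A ≤ 1 / (n : ℝ) * ∑ j, f (x j) := by
      have : ∑ j : Fin n, (1 - marginError f (x j)) ≤ ∑ j, f (x j) :=
        Finset.sum_le_sum fun j _ => by
          have := le_max_right 0 (1 - f (x j))
          rw [marginError]
          linarith
      rw [Finset.sum_sub_distrib] at this
      have h4 := mul_le_mul_of_nonneg_left this (by positivity : 0 ≤ 1 / (n : ℝ))
      rw [mul_sub, ← hA] at h4
      simpa [hn0.ne'] using h4
    have h5 := h3.trans (le_abs_self _)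
    have h6 := mul_le_mul_of_nonneg_left h5 hl.le
    have h7 := mul_le_mul_of_nonneg_left h2 hl.le
    have h8 : 0 ≤ √(n : ℝ) * (empRademacher F x).toReal := mul_nonneg hs.le ENNReal.toReal_nonneg
    rcases le_total lam 1 with h9 | h9
    · have : 0 ≤ 2 * lam * (√n * (empRademacher F x).toReal) := by positivity
      linarith
    · nlinarith
  have hdev := H hfin hlow
  have hemp : 1 / (n : ℝ) * ∑ j, ramp lam f (x j) ≤ lam * A := by
    rw [hA, mul_left_comm, Finset.mul_sum (a := lam)]
    gcongr with j
    exact ramp_le_marginError hl.le f (x j)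
  have hP := measureReal_compl_decisionRegion_le (P := P) hf hl
  have hreal : P.real (decisionRegion f (1 - 1 / lam))ᶜ
      ≤ lam * A + 2 * lam * (empRademacher F x).toReal + T / √n := by
    have : ∫ a, ramp lam f a ∂P - 1 / (n : ℝ) * ∑ j, ramp lam f (x j)
        ≤ 2 * lam * (empRademacher F x).toReal + T / √n := by
      refine le_of_mul_le_mul_left (hdev.trans_eq ?_) hs
      field_simp
      ring
    linarith
  rw [← ENNReal.ofReal_toReal hfin, ← ENNReal.ofReal_mul (by positivity),
    ← ENNReal.ofReal_add (by positivity) (by positivity),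
    ← ENNReal.ofReal_add (by positivity) (by positivity)]
  exact (ENNReal.le_ofReal_iff_toReal_le (measure_ne_top _ _) (by positivity)).2 hreal

lemma ofReal_one_sub_le_measure {Ω : Type*} [MeasurableSpace Ω] {μ : Measure Ω}
    [IsProbabilityMeasure μ] {E : Set Ω} (hE : MeasurableSet E) {η : ℝ} (h : μ.real Eᶜ ≤ η) :
    ENNReal.ofReal (1 - η) ≤ μ E := by
  rw [probReal_compl_eq_one_sub hE] at h
  exact ENNReal.ofReal_le_of_le_toReal (by rw [← Measure.real]; linarith)

/-- The uniform bound in terms of the scale `lam`, the inverse of the margin. -/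
theorem exists_event_forall_scale (hF : ∀ f ∈ F, Measurable f) (hsep : PointwiseSeparable F)
    (hn : 1 ≤ n) {η : ℝ} (hη0 : 0 < η) (hη1 : η ≤ 1) :
    ∃ E : Set (Fin n → X), MeasurableSet E ∧
      ENNReal.ofReal (1 - η) ≤ Measure.pi (fun _ : Fin n => P) E ∧
      ∀ x ∈ E, ∀ f ∈ F, ∀ lam : ℝ, 0 < lam →
        P (decisionRegion f (1 - 1 / lam))ᶜ ≤
          ENNReal.ofReal (lam * (1 / (n : ℝ) * ∑ i, marginError f (x i)))
            + ENNReal.ofReal (2 * lam) * empRademacher F x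
            + ENNReal.ofReal (confidenceTerm η / √n) := by
  rcases F.eq_empty_or_nonempty with rfl | hne
  · exact ⟨Set.univ, MeasurableSet.univ, by simp [hη0.le], by simp⟩
  have hn0 : (0 : ℝ) < n := by exact_mod_cast hn
  have hs0 : 0 < √(n : ℝ) := Real.sqrt_pos.2 hn0
  have hT := le_confidenceTerm hη0 hη1
  have hT0 : 0 ≤ confidenceTerm η := by linarith
  obtain ⟨τ, hτ⟩ : ∃ τ, confidenceTerm η = 1.766 + τ := ⟨confidenceTerm η - 1.766, by ring⟩
  have hτ0 : 0 ≤ τ := by linarith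
  set μ := Measure.pi fun _ : Fin n => P
  set ρ : (Fin n → X) → ℝ≥0∞ := fun x => ENNReal.ofReal √n * empRademacher F x with hρ
  have hρm : Measurable ρ := measurable_const.mul (measurable_empRademacher hF hsep)
  -- Level `0.8η` leaves `0.2η` for the union bound in the geometric regime; the arithmetic one does
  -- not impose `ρ ≥ M` and may spend all of `η`.
  obtain ⟨M, hM1, hM2⟩ := exists_quantile μ hρm (by positivity : 0 ≤ 0.8 * η) (by linarith)
  have hmeas : MeasurableSet {x | M ≤ ρ x} := measurableSet_le measurable_const hρm
  have hcompl : μ.real {x | M ≤ ρ x}ᶜ ≤ 0.8 * η := by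
    have : {x | M ≤ ρ x}ᶜ = {x | ρ x < M} := by ext x; simp
    rw [this]
    exact hM1
  rcases eq_or_ne M ∞ with hMtop | hMfin
  · refine ⟨{x | M ≤ ρ x}, hmeas, ofReal_one_sub_le_measure hmeas (by linarith),
      fun x hx f hf lam hl => measure_compl_decisionRegion_le hn hf (hF f hf) hl hT0 x
        fun hfin => absurd ?_ hfin⟩
    have hx' : M ≤ ρ x := hx
    rw [hMtop, top_le_iff] at hx'
    by_contra hne'
    exact ENNReal.mul_ne_top ENNReal.ofReal_ne_top hne' hx'
  obtain ⟨m, hm0, rfl⟩ : ∃ m : ℝ, 0 ≤ m ∧ M = ENNReal.ofReal m :=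
    ⟨M.toReal, ENNReal.toReal_nonneg, (ENNReal.ofReal_toReal hMfin).symm⟩
  have htail := (min_tail_lt hη0 hη1 hτ).trans_le hM2
  have hd : 0 < 0.266 + 0.65 * τ := by linarith
  have hsum : ∀ (v : ℕ → ℝ) (C : ℝ), (∀ k, 0.562 ≤ v k) →
      (∀ N, ∑ k ∈ Finset.range N, Real.exp (-2 * v k ^ 2) ≤ C) →
      ∀ N, ∑ k ∈ Finset.range N, Real.exp (-2 * (v k + 0.35 * τ) ^ 2) ≤ η * C :=
    fun v C hv hC N => by
      refine (Finset.sum_le_sum fun k _ => exp_neg_sq_le hη0 hη1 hτ (hv k)).trans ?_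
      rw [← Finset.mul_sum]
      exact mul_le_mul_of_nonneg_left (hC N) hη0.le
  rcases lt_or_ge m 0.4 with hm | hm
  · obtain ⟨E, hEm, hEP, hE⟩ := exists_peeled_bound (P := P) hn hF hsep hne
      (a := fun k : ℕ => 0.2 * k) (b := fun k : ℕ => 0.2 * (k + 1))
      (s := fun k => arithmeticMargin k + 0.35 * τ) (fun k => by positivity) (fun k => by linarith)
      (fun k => by linarith [le_arithmeticMargin k])
      (hsum arithmeticMargin 1 (fun k => by linarith [le_arithmeticMargin k])
        sum_exp_arithmeticMargin_le) hm0 hd htail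
    refine ⟨E, hEm, ofReal_one_sub_le_measure hEm (by linarith), fun x hx f hf lam hl =>
      measure_compl_decisionRegion_le hn hf (hF f hf) hl hT0 x fun hfin hlow => ?_⟩
    set k := ⌊lam / 0.2⌋₊
    have hk1 : (k : ℝ) ≤ lam / 0.2 := Nat.floor_le (by positivity)
    have hk2 : lam / 0.2 < k + 1 := Nat.lt_floor_add_one _
    rw [le_div_iff₀ (by norm_num)] at hk1
    rw [div_lt_iff₀ (by norm_num)] at hk2
    refine (hE x hx k f hf lam ⟨by linarith, by linarith⟩).trans ?_
    have h1 : 0 ≤ 2 * lam * (√n * (empRademacher F x).toReal) := by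
      have : 0 ≤ (empRademacher F x).toReal := ENNReal.toReal_nonneg
      positivity
    -- Since `lam ≥ 0.2 k`, `2.3(lam - 1) ≥ 0.46(k - 5)`. The term `-0.08 k` in the margin cancels
    -- the growth of `b·M ≤ 0.08(k + 1)`.
    have h2 : (0.46 : ℝ) * max 0 ((k : ℝ) - 5) ≤ 2 * lam * (√n * (empRademacher F x).toReal) := by
      rcases le_total (k : ℝ) 5 with h | h
      · rw [max_eq_left (by linarith)]; linarith
      · rw [max_eq_right (by linarith)]; linarith
    have h3 : (0.2 * ((k : ℝ) + 1)) * m ≤ (0.2 * (k + 1)) * 0.4 := by gcongr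
    rw [arithmeticMargin, hτ]
    linarith
  · have hm' : 0 < m := by linarith
    obtain ⟨E, hEm, hEP, hE⟩ := exists_peeled_bound (P := P) hn hF hsep hne
      (a := fun k : ℕ => if k = 0 then 0 else 0.06 * 1.2 ^ (k - 1) / m)
      (b := fun k : ℕ => 0.06 * 1.2 ^ k / m)
      (s := fun k => geometricMargin k + 0.35 * τ)
      (fun k => by split_ifs <;> positivity)
      (fun k => by
        split_ifs with h
        · positivity
        · gcongr
          · norm_num
          · omega)
      (fun k => by linarith [le_geometricMargin k])
      (hsum geometricMargin 0.2 (fun k => by linarith [le_geometricMargin k])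
        sum_exp_geometricMargin_le) hm0 hd htail
    refine ⟨{x | ENNReal.ofReal m ≤ ρ x} ∩ E, hmeas.inter hEm,
      ofReal_one_sub_le_measure (hmeas.inter hEm) ?_, fun x hx f hf lam hl =>
      measure_compl_decisionRegion_le hn hf (hF f hf) hl hT0 x fun hfin _ => ?_⟩
    · rw [Set.compl_inter]
      exact (measureReal_union_le _ _).trans (by linarith)
    have hr : m ≤ √n * (empRademacher F x).toReal := by
      have h := ENNReal.toReal_mono (ENNReal.mul_ne_top ENNReal.ofReal_ne_top hfin) hx.1
      rwa [ENNReal.toReal_mul, ENNReal.toReal_ofReal hs0.le, ENNReal.toReal_ofReal hm0] at h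
    have hlr : lam * m ≤ lam * (√n * (empRademacher F x).toReal) :=
      mul_le_mul_of_nonneg_left hr hl.le
    have hlm : 0 < lam * m := by positivity
    rcases lt_or_ge (lam * m / 0.06) 1 with h | h
    · rw [div_lt_iff₀ (by norm_num), one_mul] at h
      refine (hE x hx.2 0 f hf lam ⟨by simpa using hl.le, ?_⟩).trans ?_
      · rw [pow_zero, mul_one, le_div_iff₀ hm']
        exact h.le
      · have h2 : 0.06 / m ≤ 0.15 := by rw [div_le_iff₀ hm']; linarith
        have h3 : 0.06 / m * m = 0.06 := div_mul_cancel₀ _ hm'.ne'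
        simp only [pow_zero, mul_one, if_true, geometricMargin]
        linarith
    · obtain ⟨k, hk1, hk2⟩ := exists_nat_pow_near h (by norm_num : (1 : ℝ) < 1.2)
      rw [le_div_iff₀ (by norm_num)] at hk1
      rw [div_lt_iff₀ (by norm_num)] at hk2
      refine (hE x hx.2 (k + 1) f hf lam ⟨?_, ?_⟩).trans ?_
      · simp only [Nat.add_eq_zero_iff, one_ne_zero, and_false, if_false, Nat.add_sub_cancel]
        rw [div_le_iff₀ hm']
        linarith
      · rw [le_div_iff₀ hm']
        linarith
      · simp only [Nat.add_eq_zero_iff, one_ne_zero, and_false, if_false, Nat.add_sub_cancel,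
          geometricMargin]
        set y : ℝ := 0.06 * 1.2 ^ k with hy
        have hy0 : 0 < y := by positivity
        have e : 0.06 * (1.2 : ℝ) ^ (k + 1) = 1.2 * y := by rw [hy, pow_succ]; ring
        rw [e]
        -- This is where `m ≥ 0.4` enters. The costs `1.2y` from `b·M`, at most `0.5y` from `b - a`
        -- and `0.3y` from the margin add up to `2y ≤ 2·lam·m`.
        have h2 : y / m ≤ 2.5 * y := by rw [div_le_iff₀ hm']; nlinarith
        have h3 : 1.2 * y / m * m = 1.2 * y := div_mul_cancel₀ _ hm'.ne'
        have h4 : 1.2 * y / m - y / m = 0.2 * (y / m) := by ring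
        have h5 : y ≤ lam * m := by linarith
        linarith

end Assembly

theorem theorem1 {X : Type*} [MeasurableSpace X]
    (P : Measure X) [IsProbabilityMeasure P]
    (F : Set (X → ℝ)) (hF_meas : ∀ f ∈ F, Measurable f) (hF_sep : PointwiseSeparable F)
    (n : ℕ) (hn : 1 ≤ n) (η : ℝ) (hη0 : 0 < η) (hη1 : η ≤ 1) :
    ∃ E : Set (Fin n → X), MeasurableSet E ∧
      ENNReal.ofReal (1 - η) ≤ Measure.pi (fun _ : Fin n => P) E ∧
      ∀ x ∈ E, ∀ f ∈ F, ∀ κ : ℝ, 0 < κ →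
        P (decisionRegion f (1 - κ))ᶜ ≤
          ENNReal.ofReal (1 / (κ * (n : ℝ)) * ∑ i, marginError f (x i))
            + ENNReal.ofReal (2 / κ) * empRademacher F x
            + ENNReal.ofReal (3 * Real.sqrt (Real.log (2 / η) / (2 * (n : ℝ)))) := by
  obtain ⟨E, hEm, hEP, hE⟩ := exists_event_forall_scale (P := P) hF_meas hF_sep hn hη0 hη1
  refine ⟨E, hEm, hEP, fun x hx f hf κ hκ => ?_⟩
  have h := hE x hx f hf (1 / κ) (by positivity)
  have e1 : 1 / (κ * (n : ℝ)) * ∑ i, marginError f (x i)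
      = 1 / κ * (1 / (n : ℝ) * ∑ i, marginError f (x i)) := by
    rw [← mul_assoc, one_div_mul_one_div]
  have e2 : 3 * √(Real.log (2 / η) / (2 * (n : ℝ))) = confidenceTerm η / √n := by
    rw [confidenceTerm, mul_div_assoc, ← Real.sqrt_div' _ n.cast_nonneg, div_div]
  rw [e1, e2, show 2 / κ = 2 * (1 / κ) by ring, show 1 - κ = 1 - 1 / (1 / κ) by simp]
  exact h
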